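/- **Conventions.** Let $\widehat f(\xi)$ denote the Fourier transform on $L^2(\mathbb R)$ normalised by the kernel $e^{-ix\xi}$ (up to a constant factor), let $\Delta=\partial_x^2$, and let $e^{it\Delta}$ be the Schrödinger group on $L^2(\mathbb R;\mathbb C)$, i.e. the Fourier multiplier $e^{-it\xi^2}$. For $v:\mathbb R\to L^2(\mathbb R)$ such that $\lim_{t\to\pm\infty}v(t)$ exist in $L^2$, put $$\|v\|_{V^2}=\sup\Big(\sum_{k=1}^K\|v(t_k)-v(t_{k-1})\|_{L^2}^2\Big)^{1/2},$$ the supremum being over all finite partitions $-\infty=t_0<t_1<\dots<t_{K-1}<t_K=\infty$, with the conventions $v(-\infty):=\lim_{t\to-\infty}v(t)$ and $v(\infty):=0$. The space $V^2$ consists of all such $v$ with $\|v\|_{V^2}<\infty$. Write $u\in V^2_\Delta$ if $t\mapsto e^{-it\Delta}u(t)$ belongs to $V^2$, and $\|u\|_{V^2_\Delta}=\|e^{-it\Delta}u\|_{V^2}$. **Theorem (bilinear estimate).** Let $\lambda>0$, and let $I_1,I_2\subset\mathbb R$ be compact intervals with $\operatorname{dist}(I_1,I_2)\ge\lambda$.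 (a) There is an absolute constant $C>0$ such that for all $u_0,v_0\in L^2(\mathbb R)$ with $\widehat{u_0}=0$ a.e. outside $I_1$ and $\widehat{v_0}=0$ a.e. outside $I_2$, $$\big\|e^{it\Delta}u_0\;e^{it\Delta}v_0\big\|_{L^2_{x,t}(\mathbb R\times\mathbb R)}\le C\,\lambda^{-1/2}\,\|u_0\|_{L^2}\|v_0\|_{L^2}.$$ (b) For every $0<\varepsilon<\tfrac12$ there is a constant $C>0$ depending only on $\varepsilon$ such that for every $0<T\le1$ and all $u,v\in V^2_\Delta$ with $\widehat{u(t)}=0$ a.e. outside $I_1$ and $\widehat{v(t)}=0$ a.e. outside $I_2$ for every $t\in\mathbb R$, $$\|u\,v\|_{L^2_{x,t}(\mathbb R\times[0,T])}\le C\,T^{\varepsilon/4}\,\lambda^{-1/2+\varepsilon}\,\|u\|_{V^2_\Delta}\|v\|_{V^2_\Delta}.$$ In both parts $C$ is independent of $\lambda$, of the intervals and of the functions. -/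

import Mathlib

open MeasureTheory Filter Topology
open scoped FourierTransform ENNReal

noncomputable section

/-- The complex Hilbert space `L²(ℝ)`. -/
abbrev L2 : Type := Lp ℂ 2 (volume : Measure ℝ)

/-- The Fourier symbol of `e^{itΔ}`. Mathlib's Fourier transform uses `e^{-2πixη}`, so the variable
`η` corresponds to the angular frequency `ξ = 2πη`, and the symbol is `e^{-itξ²}`. -/
def schrodingerSymbol (t η : ℝ) : ℂ :=
  Complex.exp (((-(t * (2 * Real.pi * η) ^ 2) : ℝ) : ℂ) * Complex.I)

theorem norm_schrodingerSymbol (t η : ℝ) : ‖schrodingerSymbol t η‖ = 1 :=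
  Complex.norm_exp_ofReal_mul_I _

theorem memLp_schrodingerSymbol_mul (t : ℝ) (f : L2) :
    MemLp (fun η : ℝ => schrodingerSymbol t η * f η) 2 (volume : Measure ℝ) := by
  have hc : Continuous (fun η : ℝ => schrodingerSymbol t η) := by
    unfold schrodingerSymbol
    fun_prop
  refine (Lp.memLp f).of_le (hc.aestronglyMeasurable.mul (Lp.aestronglyMeasurable f)) ?_
  filter_upwards with η
  rw [norm_mul, norm_schrodingerSymbol, one_mul]

/-- The Schrödinger group `e^{itΔ}`, `Δ = ∂ₓ²`, on `L²(ℝ)`. -/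
def schrodinger (t : ℝ) (f : L2) : L2 :=
  𝓕⁻ ((memLp_schrodingerSymbol_mul t (𝓕 f)).toLp (fun η : ℝ => schrodingerSymbol t η * (𝓕 f : L2) η))

/-- The Fourier transform of `f` (in the angular frequency variable `ξ = 2πη`) vanishes almost
everywhere outside `I`. -/
def FreqLocalized (I : Set ℝ) (f : L2) : Prop :=
  ∀ᵐ η : ℝ, 2 * Real.pi * η ∉ I → (𝓕 f : L2) η = 0

/-- The set `𝒵` of finite partitions `-∞ = t₀ < t₁ < ⋯ < t_K = ∞`. -/
structure TimePartition where
  K : ℕ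
  point : Fin (K + 1) → EReal
  strictMono : StrictMono point
  first : point 0 = ⊥
  last : point (Fin.last K) = ⊤

/-- Values of `v` at extended times, with the conventions
`v(-∞) = lim_{t → -∞} v(t)` and `v(∞) = 0`. -/
def extendTime (v : ℝ → L2) : EReal → L2
  | ⊥ => limUnder atBot v
  | ⊤ => 0
  | (t : ℝ) => v t

/-- The `V^p` norm, as an extended nonnegative number. -/
def vNorm (p : ℝ) (v : ℝ → L2) : ℝ≥0∞ :=
  ⨆ P : TimePartition,
    (∑ k : Fin P.K,
      ‖extendTime v (P.point k.succ) - extendTime v (P.point k.castSucc)‖ₑ ^ p) ^ (1 / p)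

/-- The space `V^p`: the limits at `±∞` exist and the norm is finite. -/
def MemV (p : ℝ) (v : ℝ → L2) : Prop :=
  (∃ l, Tendsto v atBot (𝓝 l)) ∧ (∃ l, Tendsto v atTop (𝓝 l)) ∧ vNorm p v < ∞

/-- The profile `t ↦ e^{-itΔ} u(t)`. -/
def schrodingerProfile (u : ℝ → L2) : ℝ → L2 := fun t => schrodinger (-t) (u t)

/-- The space `V^p_Δ = e^{itΔ} V^p`. -/
def MemVDelta (p : ℝ) (u : ℝ → L2) : Prop := MemV p (schrodingerProfile u)

/-- The norm `‖u‖_{V^p_Δ} = ‖e^{-itΔ} u‖_{V^p}`. -/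
def vDeltaNorm (p : ℝ) (u : ℝ → L2) : ℝ≥0∞ := vNorm p (schrodingerProfile u)

/-- The norm `‖u v‖_{L²_{x, t ∈ S}} = (∫_S ∫_ℝ |u(t,x) v(t,x)|² dx dt)^{1/2}`. -/
def productL2Norm (S : Set ℝ) (u v : ℝ → L2) : ℝ≥0∞ :=
  (∫⁻ t in S, ∫⁻ x : ℝ, ‖u t x * v t x‖ₑ ^ (2 : ℝ)) ^ (1 / 2 : ℝ)

end

/-! For two free waves, Plancherel in `x` turns the product into a convolution of frequency
profiles. At fixed total frequency `σ`, put the two frequencies at `σ / 2 ± y`; up to a unimodular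
factor the time dependence is then `exp(-8π² i t y²)`. Separation of the supports keeps `|y|` away
from `0`, so on each half-line `y²` is an admissible new variable, and Plancherel in `t` costs only
the inverse Jacobian, of size `1/λ`. This is (a) (`lintegral_sq_oscillatory_le`,
`lintegral_freeWave_mul_le`). Without separation, cutting at `|y| = T^{-1/2}` gives an `L⁴` bound on
`[0, T]` with a factor `√T` (`lintegral_sq_oscillatory_Icc_le`).

For (b), a `V²` profile is 1/2-Hölder with respect to its own square variation. Sampling it on the
level sets of that variation at scale `4^{-n}` writes it as a series of step functions, the `n`-th
with `O(4^n)` values of size `O(2^{-n})` (`exists_step_decomposition`). For a pair of steps of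
levels `n, m`, summing (a) over all pairs of values is uniform in `n, m`, while the `L⁴` bound with
Cauchy-Schwarz decays like `2^{-(n+m)/2}` in `L²`. Geometric interpolation
(`eLpNorm_stepWave_mul_le`) keeps `λ^{-1/2+ε}` and gains `2^{-ε(n+m)}`, which is summable; this is
where `C` comes to depend on `ε`. -/

/-! ### Fourier inversion and Plancherel for integrable functions -/

theorem continuous_fourierInv {h : ℝ → ℂ} (hh : Integrable h) : Continuous (𝓕⁻ h) := by
  rw [Real.fourierInv_eq_fourier_comp_neg]
  exact VectorFourier.fourierIntegral_continuous Real.continuous_fourierChar (by fun_prop)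
    hh.comp_neg

theorem integral_mul_fourierInv {g h : ℝ → ℂ} (hg : Integrable g) (hh : Integrable h) :
    ∫ x, 𝓕⁻ g x * h x = ∫ x, g x * 𝓕⁻ h x := by
  have := VectorFourier.integral_fourierIntegral_smul_eq_flip (L := -innerₗ ℝ)
    (μ := volume) (ν := volume) Real.continuous_fourierChar
    (by simp only [LinearMap.neg_apply, innerₗ_apply_apply]; fun_prop) hg hh
  have hflip : (-innerₗ ℝ).flip = -innerₗ ℝ := by
    ext; simp
  rw [hflip] at this
  exact this

/-- Both sides define the same tempered distribution: against a test function, each moves the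
transform onto it. This links the abstract `L²` transform to the integral formula on which all
explicit computations rest. -/
theorem coeFn_fourierInv_toLp {h : ℝ → ℂ} (h1 : Integrable h) (h2 : MemLp h 2) :
    ((𝓕⁻ (h2.toLp h) : L2) : ℝ → ℂ) =ᵐ[volume] 𝓕⁻ h := by
  refine ae_eq_of_integral_contDiff_smul_eq ((Lp.memLp _).locallyIntegrable (by norm_num))
    (continuous_fourierInv h1).locallyIntegrable fun g g_smooth g_cpt => ?_
  have hg₁ : HasCompactSupport (Complex.ofRealCLM ∘ g) := g_cpt.comp_left rfl
  have hg₂ : ContDiff ℝ (⊤ : ℕ∞) (Complex.ofRealCLM ∘ g) := by fun_prop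
  set G := hg₁.toSchwartzMap hg₂
  have e := Lp.fourierInv_toTemperedDistribution_eq (h2.toLp h)
  have e' := congrArg (fun D => D G) e
  simp only [TemperedDistribution.fourierInv_apply, Lp.toTemperedDistribution_apply] at e'
  calc ∫ x, g x • (𝓕⁻ (h2.toLp h) : L2) x = ∫ x, G x • (𝓕⁻ (h2.toLp h) : L2) x := by
        rfl
    _ = ∫ x, (𝓕⁻ G) x • (h2.toLp h) x := e'.symm
    _ = ∫ x, 𝓕⁻ (G : ℝ → ℂ) x * h x := by
        refine integral_congr_ae ?_
        filter_upwards [h2.coeFn_toLp] with x hx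
        rw [hx, smul_eq_mul, SchwartzMap.fourierInv_coe]
    _ = ∫ x, G x * 𝓕⁻ h x := integral_mul_fourierInv G.integrable h1
    _ = _ := by
        rfl

theorem lintegral_enorm_sq (f : L2) : ∫⁻ x, ‖f x‖ₑ ^ 2 = ‖f‖ₑ ^ 2 := by
  rw [Lp.enorm_def, eLpNorm_eq_lintegral_rpow_enorm_toReal (by norm_num) (by norm_num),
    ← ENNReal.rpow_natCast, ← ENNReal.rpow_mul]
  simp

/-- Plancherel as an inequality, so that square integrability of `h` need not be checked: if it
fails, the right side is infinite. -/
theorem lintegral_enorm_fourierInv_sq_le {h : ℝ → ℂ} (h1 : Integrable h) :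
    ∫⁻ x, ‖𝓕⁻ h x‖ₑ ^ 2 ≤ ∫⁻ x, ‖h x‖ₑ ^ 2 := by
  by_cases htop : ∫⁻ x, ‖h x‖ₑ ^ 2 = ∞
  · simp [htop]
  have h2 : MemLp h 2 := by
    refine ⟨h1.1, ?_⟩
    rw [eLpNorm_lt_top_iff_lintegral_rpow_enorm_lt_top (by norm_num) (by norm_num)]
    simpa using lt_top_iff_ne_top.2 htop
  calc ∫⁻ x, ‖𝓕⁻ h x‖ₑ ^ 2 = ∫⁻ x, ‖(𝓕⁻ (h2.toLp h) : L2) x‖ₑ ^ 2 := by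
        refine lintegral_congr_ae ?_
        filter_upwards [coeFn_fourierInv_toLp h1 h2] with x hx
        rw [hx]
    _ = ‖(𝓕⁻ (h2.toLp h) : L2)‖ₑ ^ 2 := lintegral_enorm_sq _
    _ = ‖h2.toLp h‖ₑ ^ 2 := by
        have := (Lp.fourierTransformₗᵢ ℝ ℂ).symm.norm_map (h2.toLp h)
        rw [← ofReal_norm, ← ofReal_norm]
        exact congrArg (fun r => ENNReal.ofReal r ^ 2) this
    _ = ∫⁻ x, ‖h2.toLp h x‖ₑ ^ 2 := (lintegral_enorm_sq _).symm
    _ ≤ _ := by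
        refine (lintegral_congr_ae ?_).le
        filter_upwards [h2.coeFn_toLp] with x hx
        rw [hx]

theorem ENNReal.add_sq_le (a b : ℝ≥0∞) : (a + b) ^ 2 ≤ 2 * (a ^ 2 + b ^ 2) := by
  have := ENNReal.rpow_add_le_mul_rpow_add_rpow a b (p := 2) (by norm_num)
  norm_num at this
  exact this

theorem sq_lintegral_le {α : Type*} [MeasurableSpace α] (μ : Measure α) {f : α → ℝ≥0∞}
    (hf : AEMeasurable f μ) : (∫⁻ x, f x ∂μ) ^ 2 ≤ μ Set.univ * ∫⁻ x, f x ^ 2 ∂μ := by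
  have := ENNReal.lintegral_mul_le_Lp_mul_Lq μ Real.HolderConjugate.two_two
    (f := fun _ => 1) aemeasurable_const hf
  simp only [Pi.mul_apply, one_mul, ENNReal.one_rpow, lintegral_const] at this
  calc (∫⁻ x, f x ∂μ) ^ 2 ≤ _ := pow_le_pow_left' this 2
    _ = _ := by
      rw [mul_pow, ← ENNReal.rpow_natCast, ← ENNReal.rpow_mul, ← ENNReal.rpow_natCast,
        ← ENNReal.rpow_mul]
      norm_num

/-! ### Oscillatory integrals with quadratic phase -/

/-- Substituting `s = a y²` makes the integral an inverse Fourier transform in `t` of `G` divided by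
the Jacobian. After Plancherel and the substitution back, one factor `1 / |2 a y|` survives. -/
theorem lintegral_sq_oscillatory_le_of_injOn {a δ : ℝ} (ha : a ≠ 0) (hδ : 0 < δ) {S : Set ℝ}
    (hS : MeasurableSet S) (hinj : Set.InjOn (fun y : ℝ => a * y ^ 2) S)
    (hlow : ∀ y ∈ S, δ ≤ |y|) {G : ℝ → ℂ} (hG : Integrable G) :
    ∫⁻ t : ℝ, ‖∫ y in S, Real.fourierChar (t * (a * y ^ 2)) • G y‖ₑ ^ 2 ≤
      ENNReal.ofReal (1 / (2 * |a| * δ)) * ∫⁻ y in S, ‖G y‖ₑ ^ 2 := by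
  set f : ℝ → ℝ := fun y => a * y ^ 2 with hf
  set f' : ℝ → ℝ := fun y => a * (2 * y) with hf'
  set g := Function.invFunOn f S
  set K : ℝ → ℂ := fun s => |f' (g s)|⁻¹ • G (g s) with hK
  have hgf : ∀ y ∈ S, g (f y) = y := fun y hy => hinj.leftInvOn_invFunOn hy
  have hder : ∀ y ∈ S, HasDerivWithinAt f (f' y) S y := fun y _ => by
    have := ((hasDerivAt_pow 2 y).const_mul a).hasDerivWithinAt (s := S)
    simpa [hf'] using this
  have hf'0 : ∀ y ∈ S, 2 * |a| * δ ≤ |f' y| := fun y hy => by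
    rw [hf', abs_mul, abs_mul, abs_two]
    nlinarith [hlow y hy, abs_pos.2 ha]
  have hpos : 0 < 2 * |a| * δ := by positivity
  have hKf : ∀ y ∈ S, |f' y| • K (f y) = G y := fun y hy => by
    have := (hpos.trans_le (hf'0 y hy)).ne'
    simp only [hK, hgf y hy, smul_smul, mul_inv_cancel₀ this, one_smul]
  have himg : MeasurableSet (f '' S) :=
    measurable_image_of_fderivWithin hS (fun x hx => (hder x hx).hasFDerivWithinAt) hinj
  have hKint : IntegrableOn K (f '' S) := by
    rw [integrableOn_image_iff_integrableOn_abs_deriv_smul hS hder hinj]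
    exact hG.integrableOn.congr_fun (fun y hy => (hKf y hy).symm) hS
  have heq : ∀ t : ℝ, ∫ y in S, Real.fourierChar (t * (a * y ^ 2)) • G y =
      𝓕⁻ ((f '' S).indicator K) t := fun t => by
    rw [Real.fourierInv_eq]
    have h1 : ∀ v : ℝ, Real.fourierChar (inner ℝ v t) • (f '' S).indicator K v =
        (f '' S).indicator (fun v => Real.fourierChar (t * v) • K v) v := fun v => by
      by_cases hv : v ∈ f '' S
      · simp [hv]
      · simp [hv]
    simp_rw [h1]
    rw [integral_indicator himg, integral_image_eq_integral_abs_deriv_smul hS hder hinj]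
    refine setIntegral_congr_fun hS fun y hy => ?_
    rw [smul_comm, hKf y hy]
  simp_rw [heq]
  refine (lintegral_enorm_fourierInv_sq_le ((integrable_indicator_iff himg).2 hKint)).trans ?_
  have h2 : ∀ v : ℝ, ‖(f '' S).indicator K v‖ₑ ^ 2 = (f '' S).indicator (fun v => ‖K v‖ₑ ^ 2) v :=
    fun v => by by_cases hv : v ∈ f '' S <;> simp [hv]
  simp_rw [h2]
  rw [lintegral_indicator himg, lintegral_image_eq_lintegral_abs_deriv_mul hS hder hinj,
    ← lintegral_const_mul'' _ (hG.1.enorm.restrict.pow_const 2)]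
  refine setLIntegral_mono' hS fun y hy => ?_
  have hp := hpos.trans_le (hf'0 y hy)
  simp only [hK, hgf y hy]
  rw [← ofReal_norm, ← ofReal_norm, norm_smul, ← ENNReal.ofReal_pow (by positivity),
    ← ENNReal.ofReal_pow (by positivity), ← ENNReal.ofReal_mul (by positivity),
    ← ENNReal.ofReal_mul (by positivity)]
  refine ENNReal.ofReal_le_ofReal ?_
  rw [norm_inv, Real.norm_eq_abs, abs_abs]
  calc |f' y| * (|f' y|⁻¹ * ‖G y‖) ^ 2 = 1 / |f' y| * ‖G y‖ ^ 2 := by field_simp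
    _ ≤ _ := by
      gcongr
      exact hf'0 y hy

theorem integrable_fourierChar_smul {G : ℝ → ℂ} (hG : Integrable G) {p : ℝ → ℝ}
    (hp : Continuous p) : Integrable (fun y => Real.fourierChar (p y) • G y) := by
  refine hG.mono ((Real.continuous_fourierChar.comp hp).aestronglyMeasurable.smul hG.1) ?_
  filter_upwards with y
  simp

theorem lintegral_sq_oscillatory_le {a δ : ℝ} (ha : a ≠ 0) (hδ : 0 < δ)
    {G : ℝ → ℂ} (hG : Integrable G) :
    ∫⁻ t : ℝ, ‖∫ y in {y | δ ≤ |y|}, Real.fourierChar (t * (a * y ^ 2)) • G y‖ₑ ^ 2 ≤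
      ENNReal.ofReal (1 / (|a| * δ)) * ∫⁻ y in {y | δ ≤ |y|}, ‖G y‖ₑ ^ 2 := by
  have hset : {y : ℝ | δ ≤ |y|} = Set.Ici δ ∪ Set.Iic (-δ) := by
    ext y
    simp only [Set.mem_ofPred_eq, le_abs, Set.mem_union, Set.mem_Ici, Set.mem_Iic]
    rw [le_neg]
  have hdisj : Disjoint (Set.Ici δ) (Set.Iic (-δ)) := by
    rw [Set.disjoint_left]
    intro y hy hy'
    simp only [Set.mem_Ici, Set.mem_Iic] at hy hy'
    linarith
  have hI : ∀ t : ℝ, Integrable (fun y => Real.fourierChar (t * (a * y ^ 2)) • G y) :=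
    fun t => integrable_fourierChar_smul hG (by fun_prop)
  rw [hset]
  have hmeas : ∀ S : Set ℝ, AEMeasurable
      (fun t : ℝ => ∫ y in S, Real.fourierChar (t * (a * y ^ 2)) • G y) := fun S => by
    have : Continuous (fun t : ℝ => ∫ y in S, Real.fourierChar (t * (a * y ^ 2)) • G y) := by
      refine continuous_of_dominated (bound := fun y => ‖G y‖) (fun t => (hI t).1.restrict)
        (fun t => by simp) hG.norm.integrableOn ?_
      filter_upwards with y
      exact (Real.continuous_fourierChar.comp (by fun_prop)).smul continuous_const
    exact this.measurable.aemeasurable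
  calc _ ≤ ∫⁻ t : ℝ, 2 * (‖∫ y in Set.Ici δ, Real.fourierChar (t * (a * y ^ 2)) • G y‖ₑ ^ 2 +
        ‖∫ y in Set.Iic (-δ), Real.fourierChar (t * (a * y ^ 2)) • G y‖ₑ ^ 2) := by
        refine lintegral_mono fun t => ?_
        rw [setIntegral_union hdisj measurableSet_Iic (hI t).integrableOn (hI t).integrableOn]
        exact (pow_le_pow_left' (enorm_add_le _ _) 2).trans (ENNReal.add_sq_le _ _)
    _ ≤ 2 * (ENNReal.ofReal (1 / (2 * |a| * δ)) * (∫⁻ y in Set.Ici δ, ‖G y‖ₑ ^ 2) +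
          ENNReal.ofReal (1 / (2 * |a| * δ)) * (∫⁻ y in Set.Iic (-δ), ‖G y‖ₑ ^ 2)) := by
        rw [lintegral_const_mul' _ _ (by simp),
          lintegral_add_left' ((hmeas _).enorm.pow_const 2)]
        gcongr
        · refine lintegral_sq_oscillatory_le_of_injOn ha hδ measurableSet_Ici ?_ ?_ hG
          · intro x hx y hy hxy
            have hx : δ ≤ x := hx
            have hy : δ ≤ y := hy
            have := mul_left_cancel₀ ha hxy
            nlinarith
          · exact fun y hy => le_abs.2 (Or.inl hy)
        · refine lintegral_sq_oscillatory_le_of_injOn ha hδ measurableSet_Iic ?_ ?_ hG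
          · intro x hx y hy hxy
            have hx : x ≤ -δ := hx
            have hy : y ≤ -δ := hy
            have := mul_left_cancel₀ ha hxy
            nlinarith
          · exact fun y hy => le_abs.2 (Or.inr (le_neg.2 hy))
    _ = _ := by
        rw [← mul_add, ← mul_assoc, lintegral_union measurableSet_Iic hdisj]
        congr 1
        rw [show (2 : ℝ≥0∞) = ENNReal.ofReal 2 by simp, ← ENNReal.ofReal_mul (by norm_num)]
        congr 1
        field_simp

theorem lintegral_sq_oscillatory_le_of_separated {a δ : ℝ} (ha : a ≠ 0) (hδ : 0 < δ)
    {G : ℝ → ℂ} (hG : Integrable G) (h0 : ∀ᵐ y, |y| < δ → G y = 0) :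
    ∫⁻ t : ℝ, ‖∫ y, Real.fourierChar (t * (a * y ^ 2)) • G y‖ₑ ^ 2 ≤
      ENNReal.ofReal (1 / (|a| * δ)) * ∫⁻ y, ‖G y‖ₑ ^ 2 := by
  refine le_trans (le_of_eq ?_) ((lintegral_sq_oscillatory_le ha hδ hG).trans
    (mul_le_mul_right (setLIntegral_le_lintegral _ _) _))
  congr with t
  rw [setIntegral_eq_integral_of_ae_compl_eq_zero]
  filter_upwards [h0] with y hy hy'
  rw [hy (not_le.1 hy'), smul_zero]

theorem lintegral_sq_oscillatory_Icc_le {a T : ℝ} (ha : 1 ≤ |a|) (hT : 0 < T)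
    {G : ℝ → ℂ} (hG : Integrable G) :
    ∫⁻ t in Set.Icc 0 T, ‖∫ y, Real.fourierChar (t * (a * y ^ 2)) • G y‖ₑ ^ 2 ≤
      ENNReal.ofReal (6 * √T) * ∫⁻ y, ‖G y‖ₑ ^ 2 := by
  have ha0 : a ≠ 0 := by
    rintro rfl
    norm_num at ha
  -- The part `|y| ≥ δ` costs about `1/δ`, the part `|y| < δ` costs about `δ T` by Cauchy-Schwarz in
  -- `y`; this choice balances them.
  set δ := (√T)⁻¹ with hδdef
  have hsT : 0 < √T := Real.sqrt_pos.2 hT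
  have hδ : 0 < δ := by positivity
  set S := {y : ℝ | δ ≤ |y|}
  have hS : MeasurableSet S := measurableSet_le measurable_const measurable_id.abs
  have hI : ∀ t : ℝ, Integrable (fun y => Real.fourierChar (t * (a * y ^ 2)) • G y) :=
    fun t => integrable_fourierChar_smul hG (by fun_prop)
  have hvol : volume Sᶜ ≤ ENNReal.ofReal (2 * δ) := by
    have : Sᶜ ⊆ Set.Icc (-δ) δ := fun y hy => by
      have : |y| < δ := not_le.1 hy
      exact abs_le.1 this.le
    refine (measure_mono this).trans ?_
    rw [Real.volume_Icc]
    exact ENNReal.ofReal_le_ofReal (by linarith)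
  have hin : ∀ t : ℝ, ‖∫ y in Sᶜ, Real.fourierChar (t * (a * y ^ 2)) • G y‖ₑ ^ 2 ≤
      ENNReal.ofReal (2 * δ) * ∫⁻ y, ‖G y‖ₑ ^ 2 := fun t => by
    calc _ ≤ (∫⁻ y in Sᶜ, ‖G y‖ₑ) ^ 2 := by
          refine pow_le_pow_left' ((enorm_integral_le_lintegral_enorm _).trans_eq ?_) 2
          congr with y
          rw [← ofReal_norm, ← ofReal_norm, Circle.norm_smul]
      _ ≤ _ := sq_lintegral_le _ hG.1.enorm.restrict
      _ ≤ _ := by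
          rw [Measure.restrict_apply_univ]
          gcongr
          exact Measure.restrict_le_self
  calc _ ≤ ∫⁻ t in Set.Icc 0 T,
          (2 * ‖∫ y in S, Real.fourierChar (t * (a * y ^ 2)) • G y‖ₑ ^ 2 +
            2 * (ENNReal.ofReal (2 * δ) * ∫⁻ y, ‖G y‖ₑ ^ 2)) := by
        refine lintegral_mono fun t => ?_
        rw [← integral_add_compl hS (hI t)]
        refine (pow_le_pow_left' (enorm_add_le _ _) 2).trans ((ENNReal.add_sq_le _ _).trans ?_)
        rw [mul_add]
        gcongr
        exact hin t
    _ = 2 * (∫⁻ t in Set.Icc 0 T, ‖∫ y in S, Real.fourierChar (t * (a * y ^ 2)) • G y‖ₑ ^ 2) +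
          2 * (ENNReal.ofReal (2 * δ) * ∫⁻ y, ‖G y‖ₑ ^ 2) * ENNReal.ofReal T := by
        rw [lintegral_add_right _ measurable_const, lintegral_const_mul' _ _ (by simp)]
        simp
    _ ≤ 2 * (ENNReal.ofReal (1 / (|a| * δ)) * ∫⁻ y, ‖G y‖ₑ ^ 2) +
          2 * (ENNReal.ofReal (2 * δ) * ∫⁻ y, ‖G y‖ₑ ^ 2) * ENNReal.ofReal T := by
        gcongr
        exact (setLIntegral_le_lintegral _ _).trans ((lintegral_sq_oscillatory_le ha0 hδ hG).trans
          (mul_le_mul_right (setLIntegral_le_lintegral _ _) _))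
    _ = (2 * ENNReal.ofReal (1 / (|a| * δ)) + 2 * ENNReal.ofReal (2 * δ) * ENNReal.ofReal T) *
          ∫⁻ y, ‖G y‖ₑ ^ 2 := by ring
    _ ≤ _ := by
        gcongr
        rw [show (2 : ℝ≥0∞) = ENNReal.ofReal 2 by simp, ← ENNReal.ofReal_mul (by norm_num),
          ← ENNReal.ofReal_mul (by norm_num), ← ENNReal.ofReal_mul (by positivity),
          ← ENNReal.ofReal_add (by positivity) (by positivity)]
        refine ENNReal.ofReal_le_ofReal ?_
        have h1 : 1 / (|a| * δ) ≤ √T := by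
          rw [hδdef, div_le_iff₀ (by positivity)]
          field_simp
          exact ha
        have h2 : δ * T = √T := by
          rw [hδdef]
          field_simp
          exact (Real.sq_sqrt hT.le).symm
        nlinarith

/-! ### Products of free waves -/

/-- The free Schrödinger wave with frequency profile `F`. -/
noncomputable def freeWave (F : ℝ → ℂ) (t x : ℝ) : ℂ :=
  𝓕⁻ (fun η => schrodingerSymbol t η * F η) x

theorem continuous_schrodingerSymbol : Continuous fun p : ℝ × ℝ => schrodingerSymbol p.1 p.2 := by
  unfold schrodingerSymbol
  fun_prop

theorem integrable_schrodingerSymbol_mul {F : ℝ → ℂ} (hF : Integrable F) (t : ℝ) :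
    Integrable fun η => schrodingerSymbol t η * F η := by
  refine hF.mono ((continuous_schrodingerSymbol.comp
    (by fun_prop : Continuous fun η : ℝ => (t, η))).aestronglyMeasurable.mul hF.1) ?_
  filter_upwards with η
  simp [norm_schrodingerSymbol]

theorem continuous_freeWave {F : ℝ → ℂ} (hF : Integrable F) :
    Continuous fun p : ℝ × ℝ => freeWave F p.1 p.2 := by
  simp only [freeWave, Real.fourierInv_eq]
  refine continuous_of_dominated (bound := fun η => ‖F η‖) (fun p => ?_) (fun p => ?_) hF.norm ?_
  · exact (integrable_fourierChar_smul (integrable_schrodingerSymbol_mul hF p.1)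
      (p := fun v => inner ℝ v p.2) (by fun_prop)).1
  · simp [norm_schrodingerSymbol]
  · filter_upwards with η
    refine Continuous.smul (continuous_subtype_val.comp
      (Real.continuous_fourierChar.comp
        (by fun_prop : Continuous fun p : ℝ × ℝ => (inner ℝ η p.2 : ℝ)))) ?_
    exact (continuous_schrodingerSymbol.comp
      (by fun_prop : Continuous fun p : ℝ × ℝ => (p.1, η))).mul continuous_const

theorem norm_freeWave_le (F : ℝ → ℂ) (t x : ℝ) : ‖freeWave F t x‖ ≤ ∫ η, ‖F η‖ := by
  rw [freeWave, Real.fourierInv_eq]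
  refine (norm_integral_le_integral_norm _).trans_eq ?_
  simp [norm_schrodingerSymbol]

theorem freeWave_add {F G : ℝ → ℂ} (hF : Integrable F) (hG : Integrable G) (t x : ℝ) :
    freeWave (fun η => F η + G η) t x = freeWave F t x + freeWave G t x := by
  simp only [freeWave, Real.fourierInv_eq]
  rw [← integral_add
    (integrable_fourierChar_smul (integrable_schrodingerSymbol_mul hF t) (by fun_prop))
    (integrable_fourierChar_smul (integrable_schrodingerSymbol_mul hG t) (by fun_prop))]
  congr with η
  rw [mul_add, smul_add]

theorem freeWave_congr {F G : ℝ → ℂ} (h : F =ᵐ[volume] G) : freeWave F = freeWave G := by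
  ext t x
  refine Real.fourierInv_congr_ae ?_ x
  filter_upwards [h] with η hη
  rw [hη]

open scoped Convolution in
theorem freeWave_mul_freeWave {F G : ℝ → ℂ} (hF : Integrable F) (hG : Integrable G) (t x : ℝ) :
    freeWave F t x * freeWave G t x =
      𝓕⁻ (fun σ => ∫ η, (schrodingerSymbol t η * F η) *
        (schrodingerSymbol t (σ - η) * G (σ - η))) x := by
  rw [freeWave, freeWave, Real.fourierInv_eq_fourier_neg, Real.fourierInv_eq_fourier_neg,
    Real.fourierInv_eq_fourier_neg, ← Real.fourier_mul_convolution_eq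
      (integrable_schrodingerSymbol_mul hF t) (integrable_schrodingerSymbol_mul hG t)]
  rfl

/-- The parallelogram identity `(σ/2 + y)² + (σ/2 - y)² = σ²/2 + 2y²` splits the phase into a part
free of `y`, which has modulus one, and a multiple of `t y²`. -/
theorem enorm_integral_schrodingerSymbol_mul_mul (F G : ℝ → ℂ) (t σ : ℝ) :
    ‖∫ η, (schrodingerSymbol t η * F η) * (schrodingerSymbol t (σ - η) * G (σ - η))‖ₑ =
      ‖∫ y, Real.fourierChar (t * (-(4 * Real.pi) * y ^ 2)) •
        (F (σ / 2 + y) * G (σ / 2 - y))‖ₑ := by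
  rw [← integral_add_left_eq_self _ (σ / 2)]
  have h : ∀ y : ℝ, (schrodingerSymbol t (σ / 2 + y) * F (σ / 2 + y)) *
      (schrodingerSymbol t (σ - (σ / 2 + y)) * G (σ - (σ / 2 + y))) =
      Complex.exp ((-(2 * Real.pi ^ 2 * t * σ ^ 2) : ℝ) * Complex.I) *
        (Real.fourierChar (t * (-(4 * Real.pi) * y ^ 2)) •
          (F (σ / 2 + y) * G (σ / 2 - y))) := fun y => by
    rw [show σ - (σ / 2 + y) = σ / 2 - y by ring, mul_mul_mul_comm, Circle.smul_def,
      Real.fourierChar_apply, smul_eq_mul, ← mul_assoc (Complex.exp _), ← Complex.exp_add]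
    unfold schrodingerSymbol
    rw [← Complex.exp_add]
    congr 2
    push_cast
    ring
  simp_rw [h]
  rw [integral_const_mul, enorm_mul, ← ofReal_norm (Complex.exp _),
    Complex.norm_exp_ofReal_mul_I, ENNReal.ofReal_one, one_mul]

theorem lintegral_lintegral_mul_sub {f g : ℝ → ℝ≥0∞} (hf : Measurable f) (hg : Measurable g) :
    ∫⁻ σ, ∫⁻ y, f (σ / 2 + y) * g (σ / 2 - y) = (∫⁻ x, f x) * ∫⁻ x, g x := by
  have h1 : ∀ σ : ℝ, ∫⁻ y, f (σ / 2 + y) * g (σ / 2 - y) = ∫⁻ y, f y * g (σ - y) := fun σ => by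
    rw [← lintegral_add_left_eq_self (fun y => f y * g (σ - y)) (σ / 2)]
    refine lintegral_congr fun y => ?_
    congr 2
    ring
  simp_rw [h1]
  rw [lintegral_lintegral_swap (by fun_prop)]
  have h2 : ∀ y : ℝ, ∫⁻ σ, f y * g (σ - y) = f y * ∫⁻ x, g x := fun y => by
    rw [lintegral_const_mul _ (by fun_prop), lintegral_sub_right_eq_self]
  simp_rw [h2]
  rw [lintegral_mul_const _ hf]

/-- Plancherel in `x` and Fubini reduce both space-time bounds to an estimate in `t` on each fibre
of fixed `σ`, uniform in `σ`. -/
theorem lintegral_freeWave_mul_le {F G : ℝ → ℂ} (hF : Integrable F) (hG : Integrable G)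
    (mF : Measurable F) (mG : Measurable G) {S : Set ℝ} {A : ℝ≥0∞}
    (hA : ∀ σ, Integrable (fun y => F (σ / 2 + y) * G (σ / 2 - y)) →
      ∫⁻ t in S, ‖∫ y, Real.fourierChar (t * (-(4 * Real.pi) * y ^ 2)) •
        (F (σ / 2 + y) * G (σ / 2 - y))‖ₑ ^ 2 ≤
        A * ∫⁻ y, ‖F (σ / 2 + y) * G (σ / 2 - y)‖ₑ ^ 2) :
    ∫⁻ t in S, ∫⁻ x, ‖freeWave F t x * freeWave G t x‖ₑ ^ 2 ≤
      A * (∫⁻ η, ‖F η‖ₑ ^ 2) * ∫⁻ η, ‖G η‖ₑ ^ 2 := by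
  have hmeas : Measurable fun p : ℝ × ℝ =>
      ∫ y, Real.fourierChar (p.1 * (-(4 * Real.pi) * y ^ 2)) •
        (F (p.2 / 2 + y) * G (p.2 / 2 - y)) := by
    refine (StronglyMeasurable.integral_prod_right' (ν := volume)
      (f := fun q : (ℝ × ℝ) × ℝ => Real.fourierChar (q.1.1 * (-(4 * Real.pi) * q.2 ^ 2)) •
        (F (q.1.2 / 2 + q.2) * G (q.1.2 / 2 - q.2))) ?_).measurable
    refine Measurable.stronglyMeasurable ?_
    have hc : Continuous fun q : (ℝ × ℝ) × ℝ =>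
        (Real.fourierChar (q.1.1 * (-(4 * Real.pi) * q.2 ^ 2)) : ℂ) :=
      continuous_subtype_val.comp (Real.continuous_fourierChar.comp (by fun_prop))
    simp only [Circle.smul_def]
    exact hc.measurable.smul (by fun_prop)
  calc ∫⁻ t in S, ∫⁻ x, ‖freeWave F t x * freeWave G t x‖ₑ ^ 2
      ≤ ∫⁻ t in S, ∫⁻ σ, ‖∫ y, Real.fourierChar (t * (-(4 * Real.pi) * y ^ 2)) •
        (F (σ / 2 + y) * G (σ / 2 - y))‖ₑ ^ 2 := by
        refine lintegral_mono fun t => ?_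
        simp_rw [freeWave_mul_freeWave hF hG]
        refine (lintegral_enorm_fourierInv_sq_le ?_).trans_eq ?_
        · exact (integrable_schrodingerSymbol_mul hF t).integrable_convolution
            (ContinuousLinearMap.mul ℂ ℂ) (integrable_schrodingerSymbol_mul hG t)
        · simp_rw [enorm_integral_schrodingerSymbol_mul_mul]
    _ = ∫⁻ σ, ∫⁻ t in S, ‖∫ y, Real.fourierChar (t * (-(4 * Real.pi) * y ^ 2)) •
        (F (σ / 2 + y) * G (σ / 2 - y))‖ₑ ^ 2 :=
        lintegral_lintegral_swap (hmeas.enorm.pow_const 2).aemeasurable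
    _ ≤ ∫⁻ σ, A * ∫⁻ y, ‖F (σ / 2 + y) * G (σ / 2 - y)‖ₑ ^ 2 := by
        refine lintegral_mono_ae ?_
        -- The fibre function is integrable only for almost every `σ`, hence the premise in `hA`.
        filter_upwards [hF.ae_convolution_exists (ContinuousLinearMap.mul ℂ ℂ) hG] with σ hσ
        refine hA σ ?_
        have : Integrable (fun y => F y * G (σ - y)) := hσ
        have := this.comp_add_left (σ / 2)
        refine this.congr (ae_of_all _ fun y => ?_)
        simp only
        rw [show σ - (σ / 2 + y) = σ / 2 - y by ring]
    _ = A * ∫⁻ σ, ∫⁻ y, ‖F (σ / 2 + y)‖ₑ ^ 2 * ‖G (σ / 2 - y)‖ₑ ^ 2 := by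
        simp_rw [enorm_mul, mul_pow]
        rw [lintegral_const_mul]
        refine Measurable.lintegral_prod_right' (f := fun p : ℝ × ℝ =>
          ‖F (p.1 / 2 + p.2)‖ₑ ^ 2 * ‖G (p.1 / 2 - p.2)‖ₑ ^ 2) ?_
        fun_prop
    _ = _ := by
        rw [lintegral_lintegral_mul_sub (f := fun η => ‖F η‖ₑ ^ 2) (g := fun η => ‖G η‖ₑ ^ 2)
          (by fun_prop) (by fun_prop), mul_assoc]

theorem lintegral_freeWave_mul_le_of_separated {F G : ℝ → ℂ} (hF : Integrable F)
    (hG : Integrable G) (mF : Measurable F) (mG : Measurable G) {lam : ℝ} (hlam : 0 < lam)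
    (hsep : ∀ ξ η, F ξ ≠ 0 → G η ≠ 0 → lam ≤ 2 * Real.pi * |ξ - η|) :
    ∫⁻ t, ∫⁻ x, ‖freeWave F t x * freeWave G t x‖ₑ ^ 2 ≤
      ENNReal.ofReal (1 / lam) * (∫⁻ η, ‖F η‖ₑ ^ 2) * ∫⁻ η, ‖G η‖ₑ ^ 2 := by
  have hpi := Real.pi_pos
  rw [← setLIntegral_univ]
  refine lintegral_freeWave_mul_le hF hG mF mG fun σ hσ => ?_
  rw [setLIntegral_univ]
  -- The frequencies `σ / 2 ± y` differ by `2y`, so separation reads `4π|y| ≥ lam`; then `|a| δ =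
  -- lam`.
  refine (lintegral_sq_oscillatory_le_of_separated (a := -(4 * Real.pi))
    (δ := lam / (4 * Real.pi)) (by simp [hpi.ne']) (by positivity) hσ
    (ae_of_all _ fun y hy => ?_)).trans_eq ?_
  · by_contra h
    have := hsep _ _ (left_ne_zero_of_mul h) (right_ne_zero_of_mul h)
    rw [show σ / 2 + y - (σ / 2 - y) = 2 * y by ring, abs_mul, abs_two] at this
    rw [lt_div_iff₀ (by positivity)] at hy
    linarith
  · congr 3
    rw [abs_neg, abs_of_pos (by positivity)]
    field_simp

theorem lintegral_Icc_freeWave_mul_le {F G : ℝ → ℂ} (hF : Integrable F)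
    (hG : Integrable G) (mF : Measurable F) (mG : Measurable G) {T : ℝ} (hT : 0 < T) :
    ∫⁻ t in Set.Icc 0 T, ∫⁻ x, ‖freeWave F t x * freeWave G t x‖ₑ ^ 2 ≤
      ENNReal.ofReal (6 * √T) * (∫⁻ η, ‖F η‖ₑ ^ 2) * ∫⁻ η, ‖G η‖ₑ ^ 2 := by
  refine lintegral_freeWave_mul_le hF hG mF mG fun σ hσ =>
    lintegral_sq_oscillatory_Icc_le ?_ hT hσ
  rw [abs_neg, abs_of_pos (by positivity)]
  linarith [Real.pi_gt_three]

/-! ### Frequency cutoffs and pointwise values of waves -/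

theorem coeFn_fourier_schrodinger (t : ℝ) (f : L2) :
    ((𝓕 (schrodinger t f) : L2) : ℝ → ℂ) =ᵐ[volume]
      fun η => schrodingerSymbol t η * (𝓕 f : L2) η := by
  rw [schrodinger, FourierTransform.fourier_fourierInv_eq]
  exact MemLp.coeFn_toLp _

theorem schrodinger_schrodinger_neg (t : ℝ) (f : L2) : schrodinger t (schrodinger (-t) f) = f := by
  have h : (𝓕 (schrodinger t (schrodinger (-t) f)) : L2) = 𝓕 f := by
    refine Lp.ext ?_
    filter_upwards [coeFn_fourier_schrodinger t (schrodinger (-t) f),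
      coeFn_fourier_schrodinger (-t) f] with η h1 h2
    rw [h1, h2, ← mul_assoc]
    unfold schrodingerSymbol
    rw [← Complex.exp_add]
    simp
  simpa [FourierTransform.fourierInv_fourier_eq] using congrArg (fun g : L2 => (𝓕⁻ g : L2)) h

theorem freqLocalized_schrodinger {I : Set ℝ} {f : L2} (hf : FreqLocalized I f) (t : ℝ) :
    FreqLocalized I (schrodinger t f) := by
  unfold FreqLocalized at hf ⊢
  filter_upwards [hf, coeFn_fourier_schrodinger t f] with η h1 h2 h3
  rw [h2, h1 h3, mul_zero]

theorem measurableSet_angularFreq (a b : ℝ) :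
    MeasurableSet {η : ℝ | 2 * Real.pi * η ∈ Set.Icc a b} :=
  (measurable_const_mul (2 * Real.pi)) measurableSet_Icc

theorem volume_angularFreq_lt_top (a b : ℝ) :
    volume {η : ℝ | 2 * Real.pi * η ∈ Set.Icc a b} < ∞ := by
  have hpi := Real.pi_pos
  have : {η : ℝ | 2 * Real.pi * η ∈ Set.Icc a b} ⊆
      Set.Icc (a / (2 * Real.pi)) (b / (2 * Real.pi)) := by
    rintro η ⟨h1, h2⟩
    constructor
    · rw [div_le_iff₀ (by positivity)]
      linarith
    · rw [le_div_iff₀ (by positivity)]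
      linarith
  refine (measure_mono this).trans_lt ?_
  simp

/-- The Fourier transform of `f`, cut off to angular frequencies in `[a, b]`. -/
noncomputable def freqCutoff (a b : ℝ) (f : L2) : ℝ → ℂ :=
  {η : ℝ | 2 * Real.pi * η ∈ Set.Icc a b}.indicator (𝓕 f : L2)

theorem measurable_freqCutoff (a b : ℝ) (f : L2) : Measurable (freqCutoff a b f) :=
  (Lp.stronglyMeasurable _).measurable.indicator (measurableSet_angularFreq a b)

theorem integrable_freqCutoff (a b : ℝ) (f : L2) : Integrable (freqCutoff a b f) := by
  rw [freqCutoff, integrable_indicator_iff (measurableSet_angularFreq a b)]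
  have : IsFiniteMeasure (volume.restrict {η : ℝ | 2 * Real.pi * η ∈ Set.Icc a b}) :=
    ⟨by simpa using volume_angularFreq_lt_top a b⟩
  exact ((Lp.memLp (𝓕 f : L2)).restrict _).integrable (by norm_num)

theorem lintegral_enorm_freqCutoff_sq_le (a b : ℝ) (f : L2) :
    ∫⁻ η, ‖freqCutoff a b f η‖ₑ ^ 2 ≤ ‖f‖ₑ ^ 2 := by
  have h : ‖(𝓕 f : L2)‖ₑ = ‖f‖ₑ := by
    rw [← ofReal_norm, ← ofReal_norm, Lp.norm_fourier_eq]
  rw [← h, ← lintegral_enorm_sq]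
  refine lintegral_mono fun η => ?_
  gcongr
  exact enorm_indicator_le_enorm_self _ _

theorem integral_norm_freqCutoff_le (a b : ℝ) (f : L2) :
    ∫ η, ‖freqCutoff a b f η‖ ≤
      √(volume {η : ℝ | 2 * Real.pi * η ∈ Set.Icc a b}).toReal * ‖f‖ := by
  set J := {η : ℝ | 2 * Real.pi * η ∈ Set.Icc a b}
  have hJ : MeasurableSet J := measurableSet_angularFreq a b
  have hJ' : volume J < ∞ := volume_angularFreq_lt_top a b
  have h1 : (∫⁻ η, ‖freqCutoff a b f η‖ₑ) ^ 2 ≤ volume J * ‖f‖ₑ ^ 2 := by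
    have h0 : ∫⁻ η, ‖freqCutoff a b f η‖ₑ = ∫⁻ η in J, ‖freqCutoff a b f η‖ₑ := by
      rw [← lintegral_indicator hJ]
      refine lintegral_congr fun η => ?_
      by_cases hη : η ∈ J
      · rw [Set.indicator_of_mem hη]
      · rw [Set.indicator_of_notMem hη, freqCutoff, Set.indicator_of_notMem hη, enorm_zero]
    rw [h0]
    refine (sq_lintegral_le _ (measurable_freqCutoff a b f).enorm.aemeasurable).trans ?_
    rw [Measure.restrict_apply_univ]
    gcongr
    exact (setLIntegral_le_lintegral _ _).trans (lintegral_enorm_freqCutoff_sq_le a b f)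
  refine abs_le_of_sq_le_sq' ?_ (by positivity) |>.2
  rw [mul_pow, Real.sq_sqrt ENNReal.toReal_nonneg,
    integral_norm_eq_lintegral_enorm (integrable_freqCutoff a b f).1]
  have h2 := ENNReal.toReal_mono (ENNReal.mul_ne_top hJ'.ne (by simp)) h1
  rwa [ENNReal.toReal_mul, ENNReal.toReal_pow, ENNReal.toReal_pow, toReal_enorm] at h2

theorem freqCutoff_add (a b : ℝ) (f g : L2) :
    freqCutoff a b (f + g) =ᵐ[volume] fun η => freqCutoff a b f η + freqCutoff a b g η := by
  have h : (𝓕 (f + g) : L2) = 𝓕 f + 𝓕 g := FourierTransform.fourier_add f g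
  filter_upwards [Lp.coeFn_add (𝓕 f : L2) (𝓕 g : L2)] with η hη
  unfold freqCutoff
  rw [h]
  by_cases hJ : η ∈ {η : ℝ | 2 * Real.pi * η ∈ Set.Icc a b}
  · simp only [Set.indicator_of_mem hJ, hη, Pi.add_apply]
  · simp only [Set.indicator_of_notMem hJ, add_zero]

theorem FreqLocalized.freqCutoff_ae_eq {a b : ℝ} {f : L2} (hf : FreqLocalized (Set.Icc a b) f) :
    freqCutoff a b f =ᵐ[volume] (𝓕 f : L2) := by
  filter_upwards [hf] with η hη
  unfold freqCutoff
  by_cases hJ : η ∈ {η : ℝ | 2 * Real.pi * η ∈ Set.Icc a b}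
  · rw [Set.indicator_of_mem hJ]
  · rw [Set.indicator_of_notMem hJ, hη hJ]

theorem freqCutoff_ne_zero {a b : ℝ} {f : L2} {η : ℝ} (h : freqCutoff a b f η ≠ 0) :
    2 * Real.pi * η ∈ Set.Icc a b := by
  by_contra hη
  exact h (Set.indicator_of_notMem (s := {η : ℝ | 2 * Real.pi * η ∈ Set.Icc a b}) hη _)

/-- The value at `(t, x)` of the free wave with data `f` cut off to frequencies in `[a, b]`, as an
additive map of `f`. -/
noncomputable def cutoffWave (a b t x : ℝ) : L2 →+ ℂ :=
  AddMonoidHom.mk' (fun f => freeWave (freqCutoff a b f) t x) fun f g => by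
    rw [freeWave_congr (freqCutoff_add a b f g),
      freeWave_add (integrable_freqCutoff a b f) (integrable_freqCutoff a b g)]

theorem cutoffWave_apply (a b t x : ℝ) (f : L2) :
    cutoffWave a b t x f = freeWave (freqCutoff a b f) t x := rfl

/-- On a bounded frequency band the profile is in `L¹`, so point evaluation is bounded on `L²`. The
bound depends on the band, but only continuity is used: it lets a series in `L²` be evaluated at
each `(t, x)`. -/
theorem continuous_cutoffWave (a b t x : ℝ) : Continuous (cutoffWave a b t x) :=
  AddMonoidHomClass.continuous_of_bound _ _ fun f =>
    (norm_freeWave_le _ t x).trans (integral_norm_freqCutoff_le a b f)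

theorem measurable_cutoffWave (a b : ℝ) (f : L2) :
    Measurable fun p : ℝ × ℝ => cutoffWave a b p.1 p.2 f :=
  (continuous_freeWave (integrable_freqCutoff a b f)).measurable

theorem FreqLocalized.coeFn_schrodinger {a b : ℝ} {f : L2} (hf : FreqLocalized (Set.Icc a b) f)
    (t : ℝ) : (schrodinger t f : ℝ → ℂ) =ᵐ[volume] fun x => cutoffWave a b t x f := by
  have h1 : (fun η => schrodingerSymbol t η * freqCutoff a b f η) =ᵐ[volume]
      fun η => schrodingerSymbol t η * (𝓕 f : L2) η := by
    filter_upwards [hf.freqCutoff_ae_eq] with η hη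
    rw [hη]
  have h2 : Integrable fun η => schrodingerSymbol t η * (𝓕 f : L2) η :=
    (integrable_schrodingerSymbol_mul (integrable_freqCutoff a b f) t).congr h1
  refine (coeFn_fourierInv_toLp h2 (memLp_schrodingerSymbol_mul t (𝓕 f))).trans
    (ae_of_all _ fun x => ?_)
  exact (Real.fourierInv_congr_ae h1 x).symm

theorem lintegral_cutoffWave_mul_le {lam a₁ b₁ a₂ b₂ : ℝ} (hlam : 0 < lam)
    (hsep : ∀ ξ ∈ Set.Icc a₁ b₁, ∀ η ∈ Set.Icc a₂ b₂, lam ≤ |ξ - η|) (f g : L2) :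
    ∫⁻ t, ∫⁻ x, ‖cutoffWave a₁ b₁ t x f * cutoffWave a₂ b₂ t x g‖ₑ ^ 2 ≤
      ENNReal.ofReal (1 / lam) * ‖f‖ₑ ^ 2 * ‖g‖ₑ ^ 2 := by
  refine (lintegral_freeWave_mul_le_of_separated (integrable_freqCutoff a₁ b₁ f)
    (integrable_freqCutoff a₂ b₂ g) (measurable_freqCutoff a₁ b₁ f)
    (measurable_freqCutoff a₂ b₂ g) hlam fun ξ η h1 h2 => ?_).trans ?_
  · have := hsep _ (freqCutoff_ne_zero h1) _ (freqCutoff_ne_zero h2)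
    rwa [← mul_sub, abs_mul, abs_of_pos Real.two_pi_pos] at this
  · gcongr <;> exact lintegral_enorm_freqCutoff_sq_le _ _ _

theorem lintegral_Icc_cutoffWave_pow_four_le {T : ℝ} (hT : 0 < T) (a b : ℝ) (f : L2) :
    ∫⁻ t in Set.Icc 0 T, ∫⁻ x, ‖cutoffWave a b t x f‖ₑ ^ 4 ≤
      ENNReal.ofReal (6 * √T) * ‖f‖ₑ ^ 4 := by
  have h := lintegral_Icc_freeWave_mul_le (integrable_freqCutoff a b f)
    (integrable_freqCutoff a b f) (measurable_freqCutoff a b f) (measurable_freqCutoff a b f) hT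
  refine le_trans (le_of_eq ?_) (h.trans ?_)
  · simp_rw [enorm_mul, cutoffWave_apply]
    congr with t
    congr with x
    ring
  · calc _ ≤ ENNReal.ofReal (6 * √T) * ‖f‖ₑ ^ 2 * ‖f‖ₑ ^ 2 := by
          gcongr <;> exact lintegral_enorm_freqCutoff_sq_le _ _ _
      _ = _ := by ring

/-! ### Square variation and step decomposition of `V²` functions -/

/-- The partition `-∞ < s₀ < ⋯ < s_n < ∞`. -/
noncomputable def TimePartition.ofStrictMonoOn (n : ℕ) (s : ℕ → ℝ)
    (hs : StrictMonoOn s (Set.Iic n)) : TimePartition where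
  K := n + 2
  point i := if (i : ℕ) = 0 then ⊥ else if (i : ℕ) = n + 2 then ⊤ else (s (i - 1) : EReal)
  strictMono := by
    intro i j hij
    have hij : (i : ℕ) < j := hij
    have hj := j.is_lt
    have hj0 : (j : ℕ) ≠ 0 := by omega
    have hin : (i : ℕ) ≠ n + 2 := by omega
    simp only [hj0, hin, if_false]
    split_ifs
    · exact bot_lt_top
    · exact EReal.bot_lt_coe _
    · exact EReal.coe_lt_top _
    · refine EReal.coe_lt_coe_iff.2 (hs ?_ ?_ ?_)
      · simp only [Set.mem_Iic]; omega
      · simp only [Set.mem_Iic]; omega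
      · omega
  first := by simp
  last := by simp

/-- The convention `v(∞) = 0` makes the last increment `-p (s n)`, so the norm also controls the
size of `p`. -/
theorem sum_add_enorm_sq_le_vNorm (p : ℝ → L2) (n : ℕ) (s : ℕ → ℝ)
    (hs : StrictMonoOn s (Set.Iic n)) :
    ∑ k ∈ Finset.range n, ‖p (s (k + 1)) - p (s k)‖ₑ ^ 2 + ‖p (s n)‖ₑ ^ 2 ≤ vNorm 2 p ^ 2 := by
  set P := TimePartition.ofStrictMonoOn n s hs
  set pt : ℕ → EReal := fun i =>
    if i = 0 then ⊥ else if i = n + 2 then ⊤ else (s (i - 1) : EReal) with hpt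
  have h1 : (∑ k : Fin P.K,
      ‖extendTime p (P.point k.succ) - extendTime p (P.point k.castSucc)‖ₑ ^ (2 : ℝ)) ^
        (1 / 2 : ℝ) ≤ vNorm 2 p :=
    le_iSup (fun P : TimePartition => (∑ k : Fin P.K,
      ‖extendTime p (P.point k.succ) - extendTime p (P.point k.castSucc)‖ₑ ^ (2 : ℝ)) ^
        (1 / 2 : ℝ)) P
  have h2 : ∑ k : Fin P.K,
      ‖extendTime p (P.point k.succ) - extendTime p (P.point k.castSucc)‖ₑ ^ (2 : ℝ) =
      ∑ k ∈ Finset.range (n + 2), ‖extendTime p (pt (k + 1)) - extendTime p (pt k)‖ₑ ^ 2 := by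
    rw [← Fin.sum_univ_eq_sum_range
      (fun k => ‖extendTime p (pt (k + 1)) - extendTime p (pt k)‖ₑ ^ 2)]
    refine Finset.sum_congr rfl fun k _ => ?_
    rw [ENNReal.rpow_two]
    rfl
  rw [h2] at h1
  have h3 := pow_le_pow_left' h1 2
  rw [← ENNReal.rpow_natCast, ← ENNReal.rpow_mul] at h3
  norm_num at h3
  refine le_trans ?_ h3
  rw [Finset.sum_range_succ, Finset.sum_range_succ']
  -- The increment out of `-∞` is discarded.
  refine add_le_add (le_self_add.trans' (Finset.sum_le_sum fun k hk => ?_)) ?_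
  · have hk := Finset.mem_range.1 hk
    have e1 : pt (k + 1 + 1) = (s (k + 1) : EReal) := by
      simp only [hpt]
      rw [if_neg (by omega), if_neg (by omega)]
      simp
    have e2 : pt (k + 1) = (s k : EReal) := by
      simp only [hpt]
      rw [if_neg (by omega), if_neg (by omega)]
      simp
    rw [e1, e2]
    rfl
  · have e1 : pt (n + 1 + 1) = ⊤ := by simp [hpt]
    have e2 : pt (n + 1) = (s n : EReal) := by simp [hpt]
    rw [e1, e2]
    change _ ≤ ‖(0 : L2) - p (s n)‖ₑ ^ 2
    rw [zero_sub, enorm_neg]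

/-- The square variation of `p` up to time `t`. -/
noncomputable def sqVariation (p : ℝ → L2) (t : ℝ) : ℝ≥0∞ :=
  ⨆ c : {c : ℕ × (ℕ → ℝ) // StrictMonoOn c.2 (Set.Iic c.1) ∧ c.2 c.1 = t},
    ∑ k ∈ Finset.range c.1.1, ‖p (c.1.2 (k + 1)) - p (c.1.2 k)‖ₑ ^ 2

/-- Any chain ending at `s` can be prolonged by `t`. -/
theorem sqVariation_add_le {p : ℝ → L2} {s t : ℝ} (hst : s < t) :
    sqVariation p s + ‖p t - p s‖ₑ ^ 2 ≤ sqVariation p t := by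
  have : Nonempty {c : ℕ × (ℕ → ℝ) // StrictMonoOn c.2 (Set.Iic c.1) ∧ c.2 c.1 = s} :=
    ⟨⟨(0, fun _ => s), fun i hi j hj hij => by simp at hi hj; omega, rfl⟩⟩
  rw [sqVariation, ENNReal.iSup_add]
  refine iSup_le ?_
  rintro ⟨⟨n, r⟩, hr, hrn⟩
  simp only at hr hrn ⊢
  set r' : ℕ → ℝ := fun i => if i ≤ n then r i else t with hr'
  have hmono : StrictMonoOn r' (Set.Iic (n + 1)) := by
    intro i hi j hj hij
    simp only [Set.mem_Iic] at hi hj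
    have hin : i ≤ n := by omega
    simp only [hr', hin, if_true]
    split_ifs with hjn
    · exact hr hin hjn hij
    · refine lt_of_le_of_lt ?_ hst
      rw [← hrn]
      exact hr.monotoneOn hin (Set.mem_Iic.2 le_rfl) hin
  have hlast : r' (n + 1) = t := by simp [hr']
  refine le_trans (le_of_eq ?_) (le_iSup (fun c : {c : ℕ × (ℕ → ℝ) //
    StrictMonoOn c.2 (Set.Iic c.1) ∧ c.2 c.1 = t} =>
      ∑ k ∈ Finset.range c.1.1, ‖p (c.1.2 (k + 1)) - p (c.1.2 k)‖ₑ ^ 2)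
    ⟨(n + 1, r'), hmono, hlast⟩)
  simp only
  rw [Finset.sum_range_succ, hlast]
  congr 1
  · refine Finset.sum_congr rfl fun k hk => ?_
    have hk := Finset.mem_range.1 hk
    have e1 : r' (k + 1) = r (k + 1) := if_pos (by omega)
    have e2 : r' k = r k := if_pos (by omega)
    rw [e1, e2]
  · have e : r' n = s := by rw [← hrn]; exact if_pos le_rfl
    rw [e]

theorem sqVariation_add_enorm_sq_le (p : ℝ → L2) (t : ℝ) :
    sqVariation p t + ‖p t‖ₑ ^ 2 ≤ vNorm 2 p ^ 2 := by
  have : Nonempty {c : ℕ × (ℕ → ℝ) // StrictMonoOn c.2 (Set.Iic c.1) ∧ c.2 c.1 = t} :=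
    ⟨⟨(0, fun _ => t), fun i hi j hj hij => by simp at hi hj; omega, rfl⟩⟩
  rw [sqVariation, ENNReal.iSup_add]
  refine iSup_le ?_
  rintro ⟨⟨n, r⟩, hr, hrn⟩
  have h := sum_add_enorm_sq_le_vNorm p n r hr
  rwa [show r n = t from hrn] at h

theorem enorm_le_vNorm (p : ℝ → L2) (t : ℝ) : ‖p t‖ₑ ≤ vNorm 2 p := by
  have := le_add_self.trans (sqVariation_add_enorm_sq_le p t)
  exact (ENNReal.pow_le_pow_left_iff two_ne_zero).1 this

/-- `A` is the normalised square variation; superadditivity gives both monotonicity and the Hölder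
bound. -/
theorem exists_monotone_control {p : ℝ → L2} {R : ℝ} (hR : 0 < R)
    (hp : vNorm 2 p ≤ ENNReal.ofReal R) :
    ∃ A : ℝ → ℝ, Monotone A ∧ (∀ t, 0 ≤ A t ∧ A t ≤ 1) ∧
      ∀ s t, ‖p t - p s‖ ^ 2 ≤ R ^ 2 * |A t - A s| := by
  have hbd : ∀ t, sqVariation p t ≤ ENNReal.ofReal (R ^ 2) := fun t => by
    rw [ENNReal.ofReal_pow hR.le]
    exact (le_self_add.trans (sqVariation_add_enorm_sq_le p t)).trans (pow_le_pow_left' hp 2)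
  have hfin : ∀ t, sqVariation p t ≠ ∞ := fun t => ((hbd t).trans_lt ENNReal.ofReal_lt_top).ne
  have hstep : ∀ s t, s < t →
      ‖p t - p s‖ ^ 2 ≤ (sqVariation p t).toReal - (sqVariation p s).toReal := fun s t hst => by
    have h := ENNReal.toReal_mono (hfin t) (sqVariation_add_le (p := p) hst)
    rw [ENNReal.toReal_add (hfin s) (by simp), ENNReal.toReal_pow, toReal_enorm] at h
    linarith
  have hmono : Monotone fun t => (sqVariation p t).toReal / R ^ 2 := by
    intro s t hst
    rcases hst.eq_or_lt with rfl | hst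
    · exact le_rfl
    · have := hstep s t hst
      exact div_le_div_of_nonneg_right (by linarith [sq_nonneg ‖p t - p s‖]) (by positivity)
  have key : ∀ s t, s ≤ t → ‖p t - p s‖ ^ 2 ≤
      R ^ 2 * |(sqVariation p t).toReal / R ^ 2 - (sqVariation p s).toReal / R ^ 2| := by
    intro s t hst
    rcases hst.eq_or_lt with rfl | hst'
    · simp
    · have h1 := hmono hst
      simp only at h1
      rw [abs_of_nonneg (by linarith), ← sub_div, mul_div_cancel₀ _ (by positivity)]
      exact hstep s t hst'
  refine ⟨fun t => (sqVariation p t).toReal / R ^ 2, hmono,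
    fun t => ⟨by positivity, ?_⟩, fun s t => ?_⟩
  · rw [div_le_one (by positivity)]
    exact ENNReal.toReal_le_of_le_ofReal (by positivity) (hbd t)
  · rcases le_total s t with h | h
    · exact key s t h
    · rw [norm_sub_rev, abs_sub_comm]
      exact key t s h

/-- Cut time into level sets of `⌊4^n A⌋`, sample `p` once on each, and telescope over `n`. Since
`A` varies by at most `4^{-n}` on a level set, each sample is within `R / 2^n` of `p`. -/
theorem exists_step_decomposition {p : ℝ → L2} {R : ℝ} (hR : 0 < R)
    (hp : vNorm 2 p ≤ ENNReal.ofReal R) :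
    ∃ (idx : ℕ → ℝ → ℕ) (φ : ℕ → ℕ → L2), (∀ n, Measurable (idx n)) ∧
      (∀ n t, idx n t < 2 * 4 ^ n) ∧ (∀ n k, ‖φ n k‖ ≤ 3 * R / 2 ^ n) ∧
      ∀ t, HasSum (fun n => φ n (idx n t)) (p t) := by
  classical
  obtain ⟨A, hmono, hA, hctl⟩ := exists_monotone_control hR hp
  have hpR : ∀ t, ‖p t‖ ≤ R := fun t => by
    have := (enorm_le_vNorm p t).trans hp
    rw [← ofReal_norm] at this
    exact (ENNReal.ofReal_le_ofReal_iff hR.le).1 this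
  set idx : ℕ → ℝ → ℕ := fun n t => ⌊4 ^ n * A t⌋₊ with hidx
  set rep : ℕ → ℕ → ℝ := fun n => Function.invFun (idx n) with hrep
  have hrep' : ∀ n t, idx n (rep n (idx n t)) = idx n t := fun n t =>
    Function.invFun_eq ⟨t, rfl⟩
  have hclose : ∀ n s t, idx n s = idx n t → ‖p t - p s‖ ≤ R / 2 ^ n := by
    intro n s t hst
    have h4 : (0 : ℝ) < 4 ^ n := by positivity
    have hs1 := Nat.floor_le (mul_nonneg h4.le (hA s).1)
    have hs2 := Nat.lt_floor_add_one (4 ^ n * A s)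
    have ht1 := Nat.floor_le (mul_nonneg h4.le (hA t).1)
    have ht2 := Nat.lt_floor_add_one (4 ^ n * A t)
    have hst' : (⌊4 ^ n * A s⌋₊ : ℝ) = ⌊4 ^ n * A t⌋₊ := congrArg Nat.cast hst
    have habs : 4 ^ n * |A t - A s| ≤ 1 := by
      have : 4 ^ n * |A t - A s| = |4 ^ n * A t - 4 ^ n * A s| := by
        rw [← mul_sub, abs_mul, abs_of_pos h4]
      rw [this, abs_le]
      constructor <;> linarith
    refine abs_le_of_sq_le_sq' ?_ (by positivity) |>.2
    calc ‖p t - p s‖ ^ 2 ≤ R ^ 2 * |A t - A s| := hctl s t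
      _ ≤ R ^ 2 * (1 / 4 ^ n) := by
          gcongr
          rwa [le_div_iff₀ h4, mul_comm]
      _ = (R / 2 ^ n) ^ 2 := by
          rw [div_pow, ← pow_mul, mul_comm n 2, pow_mul]
          norm_num
          ring
  -- The level sets are nested, so the difference of consecutive samples depends only on the finer
  -- index.
  have hdiv : ∀ n t, idx n t = idx (n + 1) t / 4 := by
    intro n t
    simp only [hidx]
    rw [← Nat.cast_ofNat (R := ℝ) (n := 4), ← Nat.floor_div_natCast]
    congr 1
    push_cast
    rw [pow_succ]
    ring
  set step : ℕ → ℝ → L2 := fun n t => p (rep n (idx n t)) with hstep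
  have hstep_close : ∀ n t, ‖p t - step n t‖ ≤ R / 2 ^ n := fun n t =>
    hclose n _ _ (hrep' n t)
  -- The value `0` at unattained indices makes the size bound hold for every `k`.
  set φ : ℕ → ℕ → L2 := fun n k => n.casesOn (p (rep 0 k)) fun m =>
    if ∃ t, idx (m + 1) t = k then p (rep (m + 1) k) - p (rep m (k / 4)) else 0 with hφ
  have hφ0 : ∀ t, φ 0 (idx 0 t) = step 0 t := fun t => rfl
  have hφs : ∀ m t, φ (m + 1) (idx (m + 1) t) = step (m + 1) t - step m t := fun m t => by
    simp only [hφ, hstep]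
    rw [if_pos ⟨t, rfl⟩, ← hdiv]
  have hsum : ∀ n t, ∑ i ∈ Finset.range (n + 1), φ i (idx i t) = step n t := by
    intro n t
    induction n with
    | zero => simp [hφ0]
    | succ n ih => rw [Finset.sum_range_succ, ih, hφs]; abel
  have hφb : ∀ n k, ‖φ n k‖ ≤ 3 * R / 2 ^ n := by
    intro n k
    cases n with
    | zero =>
      refine (hpR _).trans ?_
      simp
      linarith
    | succ m =>
      by_cases hk : ∃ t, idx (m + 1) t = k
      · obtain ⟨t, rfl⟩ := hk
        rw [hφs]
        calc ‖step (m + 1) t - step m t‖ = ‖(p t - step m t) - (p t - step (m + 1) t)‖ := by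
              congr 1; abel
          _ ≤ R / 2 ^ m + R / 2 ^ (m + 1) :=
              (norm_sub_le _ _).trans (add_le_add (hstep_close m t) (hstep_close (m + 1) t))
          _ = 3 * R / 2 ^ (m + 1) := by
              rw [pow_succ]
              field_simp
              ring
      · simp only [hφ]
        rw [if_neg hk, norm_zero]
        positivity
  refine ⟨idx, φ, fun n => ?_, fun n t => ?_, hφb, fun t => ?_⟩
  · exact Nat.measurable_floor.comp (hmono.measurable.const_mul _)
  · have h1 : idx n t ≤ 4 ^ n := by
      refine Nat.floor_le_of_le ?_
      push_cast
      exact mul_le_of_le_one_right (by positivity) (hA t).2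
    have : 0 < 4 ^ n := by positivity
    omega
  · have hgeo : Tendsto (fun n : ℕ => R / 2 ^ n) atTop (𝓝 0) := by
      have := (tendsto_pow_atTop_nhds_zero_of_lt_one (r := (1 / 2 : ℝ)) (by norm_num)
        (by norm_num)).const_mul R
      simpa [div_eq_mul_inv] using this
    have hsm : Summable fun n => φ n (idx n t) := by
      refine Summable.of_norm_bounded (g := fun n => 3 * R * (1 / 2) ^ n)
        ((summable_geometric_of_lt_one (by norm_num) (by norm_num)).mul_left _) fun n => ?_
      refine (hφb n _).trans_eq ?_
      rw [div_pow, one_pow]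
      ring
    have hlim : Tendsto (fun n => ∑ i ∈ Finset.range (n + 1), φ i (idx i t)) atTop (𝓝 (p t)) := by
      simp_rw [hsum]
      rw [tendsto_iff_norm_sub_tendsto_zero]
      refine squeeze_zero (fun n => norm_nonneg _) (fun n => ?_) hgeo
      rw [norm_sub_rev]
      exact hstep_close n t
    have := hsm.hasSum.tendsto_sum_nat.comp (tendsto_add_atTop_nat 1)
    rw [tendsto_nhds_unique hlim this]
    exact hsm.hasSum

theorem measurable_indexed {F : ℕ → ℝ × ℝ → ℂ} (hF : ∀ k, Measurable (F k)) {idx : ℝ → ℕ}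
    (hidx : Measurable idx) : Measurable fun q : ℝ × ℝ => F (idx q.1) q := by
  have h : Measurable fun r : ℕ × (ℝ × ℝ) => F r.1 r.2 :=
    measurable_from_prod_countable_right hF
  exact h.comp ((hidx.comp measurable_fst).prodMk measurable_id)

theorem measurable_stepWave (a b : ℝ) {idx : ℝ → ℕ} (hidx : Measurable idx) (φ : ℕ → L2) :
    Measurable fun q : ℝ × ℝ => cutoffWave a b q.1 q.2 (φ (idx q.1)) :=
  measurable_indexed (F := fun k q => cutoffWave a b q.1 q.2 (φ k))
    (fun k => measurable_cutoffWave a b (φ k)) hidx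

/-! ### Step waves, interpolation and summation -/

/-- The measure `dx dt` on `[0, T] × ℝ`. -/
noncomputable def slab (T : ℝ) : Measure (ℝ × ℝ) :=
  (volume.restrict (Set.Icc 0 T)).prod volume

theorem lintegral_slab (T : ℝ) {f : ℝ × ℝ → ℝ≥0∞} (hf : Measurable f) :
    ∫⁻ q, f q ∂slab T = ∫⁻ t in Set.Icc 0 T, ∫⁻ x, f (t, x) :=
  lintegral_prod _ hf.aemeasurable

/-- At each time one pair of values is active, so the integrand is at most the sum over all pairs,
each a product of genuine free waves. -/
theorem lintegral_stepWave_mul_le {lam a₁ b₁ a₂ b₂ : ℝ} (hlam : 0 < lam)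
    (hsep : ∀ ξ ∈ Set.Icc a₁ b₁, ∀ η ∈ Set.Icc a₂ b₂, lam ≤ |ξ - η|) (T : ℝ)
    {idx idx' : ℝ → ℕ} {M M' : ℕ} (hM : ∀ t, idx t < M) (hM' : ∀ t, idx' t < M') {φ ψ : ℕ → L2} {ρ ρ' : ℝ≥0∞}
    (hφ : ∀ k, ‖φ k‖ₑ ≤ ρ) (hψ : ∀ k, ‖ψ k‖ₑ ≤ ρ') :
    ∫⁻ q, ‖cutoffWave a₁ b₁ q.1 q.2 (φ (idx q.1)) *
        cutoffWave a₂ b₂ q.1 q.2 (ψ (idx' q.1))‖ₑ ^ 2 ∂slab T ≤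
      ENNReal.ofReal (1 / lam) * (M * ρ ^ 2) * (M' * ρ' ^ 2) := by
  have hm : ∀ j k, Measurable fun q : ℝ × ℝ =>
      ‖cutoffWave a₁ b₁ q.1 q.2 (φ j) * cutoffWave a₂ b₂ q.1 q.2 (ψ k)‖ₑ ^ 2 := fun j k =>
    ((measurable_cutoffWave a₁ b₁ (φ j)).mul (measurable_cutoffWave a₂ b₂ (ψ k))).enorm.pow_const 2
  calc _ ≤ ∫⁻ q, ∑ j ∈ Finset.range M, ∑ k ∈ Finset.range M',
        ‖cutoffWave a₁ b₁ q.1 q.2 (φ j) * cutoffWave a₂ b₂ q.1 q.2 (ψ k)‖ₑ ^ 2 ∂slab T := by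
        refine lintegral_mono fun q => ?_
        refine le_trans ?_ (Finset.single_le_sum (fun _ _ => zero_le)
          (Finset.mem_range.2 (hM q.1)))
        exact Finset.single_le_sum (f := fun k => ‖cutoffWave a₁ b₁ q.1 q.2 (φ (idx q.1)) *
          cutoffWave a₂ b₂ q.1 q.2 (ψ k)‖ₑ ^ 2) (fun _ _ => zero_le)
          (Finset.mem_range.2 (hM' q.1))
    _ = ∑ j ∈ Finset.range M, ∑ k ∈ Finset.range M', ∫⁻ q,
        ‖cutoffWave a₁ b₁ q.1 q.2 (φ j) * cutoffWave a₂ b₂ q.1 q.2 (ψ k)‖ₑ ^ 2 ∂slab T := by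
        rw [lintegral_finsetSum _ fun j _ => Finset.measurable_fun_sum _ fun k _ => hm j k]
        exact Finset.sum_congr rfl fun j _ => lintegral_finsetSum _ fun k _ => hm j k
    _ ≤ ∑ j ∈ Finset.range M, ∑ k ∈ Finset.range M',
        ENNReal.ofReal (1 / lam) * ρ ^ 2 * ρ' ^ 2 := by
        refine Finset.sum_le_sum fun j _ => Finset.sum_le_sum fun k _ => ?_
        rw [lintegral_slab T (hm j k)]
        refine (setLIntegral_le_lintegral _ _).trans
          ((lintegral_cutoffWave_mul_le hlam hsep _ _).trans ?_)
        gcongr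
        · exact hφ j
        · exact hψ k
    _ = _ := by
        simp only [Finset.sum_const, Finset.card_range, nsmul_eq_mul]
        ring

theorem lintegral_stepWave_pow_four_le {T : ℝ} (hT : 0 < T) (a b : ℝ) {idx : ℝ → ℕ} {M : ℕ}
    (hM : ∀ t, idx t < M) {φ : ℕ → L2} {ρ : ℝ≥0∞}
    (hφ : ∀ k, ‖φ k‖ₑ ≤ ρ) :
    ∫⁻ q, ‖cutoffWave a b q.1 q.2 (φ (idx q.1))‖ₑ ^ 4 ∂slab T ≤
      ENNReal.ofReal (6 * √T) * (M * ρ ^ 4) := by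
  have hm : ∀ j, Measurable fun q : ℝ × ℝ => ‖cutoffWave a b q.1 q.2 (φ j)‖ₑ ^ 4 := fun j =>
    (measurable_cutoffWave a b (φ j)).enorm.pow_const 4
  calc _ ≤ ∫⁻ q, ∑ j ∈ Finset.range M, ‖cutoffWave a b q.1 q.2 (φ j)‖ₑ ^ 4 ∂slab T :=
        lintegral_mono fun q => Finset.single_le_sum
          (f := fun j => ‖cutoffWave a b q.1 q.2 (φ j)‖ₑ ^ 4) (fun _ _ => zero_le)
          (Finset.mem_range.2 (hM q.1))
    _ = ∑ j ∈ Finset.range M, ∫⁻ q, ‖cutoffWave a b q.1 q.2 (φ j)‖ₑ ^ 4 ∂slab T :=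
        lintegral_finsetSum _ fun j _ => hm j
    _ ≤ ∑ j ∈ Finset.range M, ENNReal.ofReal (6 * √T) * ρ ^ 4 := by
        refine Finset.sum_le_sum fun j _ => ?_
        rw [lintegral_slab T (hm j)]
        refine (lintegral_Icc_cutoffWave_pow_four_le hT a b _).trans ?_
        gcongr
        exact hφ j
    _ = _ := by
        simp only [Finset.sum_const, Finset.card_range, nsmul_eq_mul]
        ring

theorem lintegral_enorm_mul_sq_le {α : Type*} [MeasurableSpace α] (μ : Measure α) {f g : α → ℂ}
    (hf : Measurable f) (hg : Measurable g) :
    ∫⁻ q, ‖f q * g q‖ₑ ^ 2 ∂μ ≤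
      (∫⁻ q, ‖f q‖ₑ ^ 4 ∂μ) ^ (1 / 2 : ℝ) * (∫⁻ q, ‖g q‖ₑ ^ 4 ∂μ) ^ (1 / 2 : ℝ) := by
  have h := ENNReal.lintegral_mul_le_Lp_mul_Lq μ Real.HolderConjugate.two_two
    (f := fun q => ‖f q‖ₑ ^ 2) (g := fun q => ‖g q‖ₑ ^ 2)
    (by fun_prop) (by fun_prop)
  simpa only [Pi.mul_apply, ENNReal.rpow_two, ← pow_mul, enorm_mul, mul_pow] using h

theorem eLpNorm_two_eq {α : Type*} [MeasurableSpace α] (μ : Measure α) (f : α → ℂ) :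
    eLpNorm f 2 μ = (∫⁻ q, ‖f q‖ₑ ^ 2 ∂μ) ^ (1 / 2 : ℝ) := by
  rw [eLpNorm_eq_lintegral_rpow_enorm_toReal (by norm_num) (by norm_num)]
  simp

theorem interpolation_bound {Y lam T ε : ℝ} (hY : 0 ≤ Y) (hlam : 0 < lam) (hT : 0 < T)
    (hT1 : T ≤ 1) (hε : 0 < ε) (N : ℕ) :
    (Y / lam) ^ (1 / 2 - ε) * (Y * √T / 2 ^ N) ^ ε ≤
      √Y * (T ^ (ε / 4) * lam ^ (-(1 / 2) + ε)) * ((1 / 2) ^ ε) ^ N := by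
  rcases hY.eq_or_lt with rfl | hY
  · simp [hε.ne']
  have h2 : (0 : ℝ) < 2 ^ N := by positivity
  rw [Real.div_rpow hY.le hlam.le, Real.div_rpow (by positivity) h2.le,
    Real.mul_rpow hY.le (Real.sqrt_nonneg T), Real.sqrt_eq_rpow, Real.sqrt_eq_rpow,
    ← Real.rpow_mul hT.le, show -(1 / 2) + ε = -(1 / 2 - ε) by ring, Real.rpow_neg hlam.le,
    ← Real.rpow_natCast 2 N, ← Real.rpow_mul zero_le_two, one_div 2, Real.inv_rpow zero_le_two,
    inv_pow, ← Real.rpow_natCast (2 ^ ε), ← Real.rpow_mul zero_le_two, mul_comm (N : ℝ) ε]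
  have hYe : Y ^ (2⁻¹ - ε) * Y ^ ε = Y ^ (2⁻¹ : ℝ) := by
    rw [← Real.rpow_add hY]
    congr 1
    ring
  -- The argument yields `T^{ε/2}`; it is weakened using `T ≤ 1`.
  have hTe : T ^ (2⁻¹ * ε) ≤ T ^ (ε / 4) := by
    refine Real.rpow_le_rpow_of_exponent_ge hT hT1 ?_
    linarith
  calc _ = Y ^ (2⁻¹ - ε) * Y ^ ε * (T ^ (2⁻¹ * ε) * (lam ^ (2⁻¹ - ε))⁻¹) *
        (2 ^ (ε * (N : ℝ)))⁻¹ := by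
        field_simp
    _ ≤ _ := by
        rw [hYe]
        gcongr

theorem eLpNorm_stepWave_mul_le {ε : ℝ} (hε : 0 < ε) (hε' : ε < 1 / 2)
    {T lam a₁ b₁ a₂ b₂ : ℝ} (hT : 0 < T) (hT1 : T ≤ 1) (hlam : 0 < lam)
    (hsep : ∀ ξ ∈ Set.Icc a₁ b₁, ∀ η ∈ Set.Icc a₂ b₂, lam ≤ |ξ - η|) {n m : ℕ}
    {idx idx' : ℝ → ℕ} (hidx : Measurable idx) (hidx' : Measurable idx')
    (hM : ∀ t, idx t < 2 * 4 ^ n) (hM' : ∀ t, idx' t < 2 * 4 ^ m) {φ ψ : ℕ → L2} {R R' : ℝ}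
    (hR : 0 < R) (hR' : 0 < R')
    (hφ : ∀ k, ‖φ k‖ ≤ 3 * R / 2 ^ n) (hψ : ∀ k, ‖ψ k‖ ≤ 3 * R' / 2 ^ m) :
    eLpNorm (fun q : ℝ × ℝ => cutoffWave a₁ b₁ q.1 q.2 (φ (idx q.1)) *
        cutoffWave a₂ b₂ q.1 q.2 (ψ (idx' q.1))) 2 (slab T) ≤
      ENNReal.ofReal (32 * (R * R') * (T ^ (ε / 4) * lam ^ (-(1 / 2) + ε)) *
        ((1 / 2) ^ ε) ^ (n + m)) := by
  have hφ' : ∀ k, ‖φ k‖ₑ ≤ ENNReal.ofReal (3 * R / 2 ^ n) := fun k => by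
    rw [← ofReal_norm]
    exact ENNReal.ofReal_le_ofReal (hφ k)
  have hψ' : ∀ k, ‖ψ k‖ₑ ≤ ENNReal.ofReal (3 * R' / 2 ^ m) := fun k => by
    rw [← ofReal_norm]
    exact ENNReal.ofReal_le_ofReal (hψ k)
  have hcast : ∀ N : ℕ, ((2 * 4 ^ N : ℕ) : ℝ≥0∞) = ENNReal.ofReal (2 * (2 ^ N) ^ 2) := fun N => by
    rw [← ENNReal.ofReal_natCast, ← pow_mul, mul_comm N 2, pow_mul]
    norm_num
  rw [eLpNorm_two_eq]
  set X := ∫⁻ q, ‖cutoffWave a₁ b₁ q.1 q.2 (φ (idx q.1)) *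
        cutoffWave a₂ b₂ q.1 q.2 (ψ (idx' q.1))‖ₑ ^ 2 ∂slab T
  -- `972 = 6 · 2 · 3⁴` comes from the `L⁴` bound. The separated bound gives `324 = (2 · 3²)²`,
  -- enlarged so that both share `Y`.
  set Y := 972 * (R * R') ^ 2
  have hsT : 0 < √T := Real.sqrt_pos.2 hT
  have h1 : X ≤ ENNReal.ofReal (Y / lam) := by
    refine (lintegral_stepWave_mul_le hlam hsep T hM hM' hφ' hψ').trans ?_
    rw [hcast, hcast, ← ENNReal.ofReal_pow (by positivity), ← ENNReal.ofReal_pow (by positivity),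
      ← ENNReal.ofReal_mul (by positivity), ← ENNReal.ofReal_mul (by positivity),
      ← ENNReal.ofReal_mul (by positivity), ← ENNReal.ofReal_mul (by positivity)]
    refine ENNReal.ofReal_le_ofReal ?_
    calc _ = 324 * (R * R') ^ 2 / lam := by
          field_simp
          ring
      _ ≤ _ := by
          gcongr
          simp only [Y]
          nlinarith [sq_nonneg (R * R')]
  have h4 : ∀ (a b r : ℝ) (N : ℕ) (i : ℝ → ℕ) (χ : ℕ → L2), 0 < r →
      (∀ t, i t < 2 * 4 ^ N) → (∀ k, ‖χ k‖ₑ ≤ ENNReal.ofReal (3 * r / 2 ^ N)) →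
      (∫⁻ q, ‖cutoffWave a b q.1 q.2 (χ (i q.1))‖ₑ ^ 4 ∂slab T) ^ (1 / 2 : ℝ) ≤
        ENNReal.ofReal (√(972 * √T) * (r ^ 2 / 2 ^ N)) := by
    intro a b r N i χ hr hN hχ
    have hsq : (√(972 * √T) * (r ^ 2 / 2 ^ N)) ^ 2 =
        6 * √T * (2 * (2 ^ N) ^ 2 * (3 * r / 2 ^ N) ^ 4) := by
      rw [mul_pow, Real.sq_sqrt (by positivity)]
      field_simp
      ring
    calc _ ≤ (ENNReal.ofReal ((√(972 * √T) * (r ^ 2 / 2 ^ N)) ^ 2)) ^ (1 / 2 : ℝ) := by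
          refine ENNReal.rpow_le_rpow ?_ (by norm_num)
          refine (lintegral_stepWave_pow_four_le hT a b hN hχ).trans_eq ?_
          rw [hcast, ← ENNReal.ofReal_pow (by positivity), ← ENNReal.ofReal_mul (by positivity),
            ← ENNReal.ofReal_mul (by positivity), hsq]
      _ = _ := by
          rw [ENNReal.ofReal_rpow_of_nonneg (by positivity) (by norm_num), ← Real.sqrt_eq_rpow,
            Real.sqrt_sq (by positivity)]
  have h2 : X ≤ ENNReal.ofReal (Y * √T / 2 ^ (n + m)) := by
    refine (lintegral_enorm_mul_sq_le _ (measurable_stepWave a₁ b₁ hidx φ)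
      (measurable_stepWave a₂ b₂ hidx' ψ)).trans ?_
    refine (mul_le_mul' (h4 a₁ b₁ R n idx φ hR hM hφ')
      (h4 a₂ b₂ R' m idx' ψ hR' hM' hψ')).trans_eq ?_
    rw [← ENNReal.ofReal_mul (by positivity)]
    congr 1
    calc _ = √(972 * √T) ^ 2 * (R ^ 2 / 2 ^ n * (R' ^ 2 / 2 ^ m)) := by ring
      _ = _ := by
          rw [Real.sq_sqrt (by positivity), pow_add]
          simp only [Y]
          field_simp
  calc X ^ (1 / 2 : ℝ) = X ^ (1 / 2 - ε) * X ^ ε := by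
        rw [← ENNReal.rpow_add_of_nonneg _ _ (by linarith) hε.le]
        congr 1
        ring
    _ ≤ ENNReal.ofReal (Y / lam) ^ (1 / 2 - ε) * ENNReal.ofReal (Y * √T / 2 ^ (n + m)) ^ ε := by
        gcongr
    _ = ENNReal.ofReal ((Y / lam) ^ (1 / 2 - ε) * (Y * √T / 2 ^ (n + m)) ^ ε) := by
        rw [ENNReal.ofReal_rpow_of_nonneg (by positivity) (by linarith),
          ENNReal.ofReal_rpow_of_nonneg (by positivity) hε.le,
          ← ENNReal.ofReal_mul (by positivity)]
    _ ≤ _ := by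
        refine ENNReal.ofReal_le_ofReal ?_
        refine (interpolation_bound (by positivity) hlam hT hT1 hε _).trans ?_
        gcongr
        -- `972 ≤ 32²`.
        refine Real.sqrt_le_iff.2 ⟨by positivity, ?_⟩
        simp only [Y]
        nlinarith [sq_nonneg (R * R')]

/-- The double series of step-wave products converges at every point, which gives measurability; its
norms are dominated by a double geometric series of ratio `2^{-ε}`. -/
theorem eLpNorm_cutoffWave_mul_le_of_vNorm_le {ε : ℝ} (hε : 0 < ε) (hε' : ε < 1 / 2)
    {T lam a₁ b₁ a₂ b₂ : ℝ} (hT : 0 < T) (hT1 : T ≤ 1) (hlam : 0 < lam)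
    (hsep : ∀ ξ ∈ Set.Icc a₁ b₁, ∀ η ∈ Set.Icc a₂ b₂, lam ≤ |ξ - η|)
    {p p' : ℝ → L2} {R R' : ℝ} (hR : 0 < R) (hR' : 0 < R')
    (hp : vNorm 2 p ≤ ENNReal.ofReal R) (hp' : vNorm 2 p' ≤ ENNReal.ofReal R') :
    (AEStronglyMeasurable (fun q : ℝ × ℝ => cutoffWave a₁ b₁ q.1 q.2 (p q.1) *
        cutoffWave a₂ b₂ q.1 q.2 (p' q.1)) (slab T)) ∧
    eLpNorm (fun q : ℝ × ℝ => cutoffWave a₁ b₁ q.1 q.2 (p q.1) *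
        cutoffWave a₂ b₂ q.1 q.2 (p' q.1)) 2 (slab T) ≤
      ENNReal.ofReal (32 * (1 - (1 / 2) ^ ε)⁻¹ ^ 2 * T ^ (ε / 4) * lam ^ (-(1 / 2) + ε)) *
        ENNReal.ofReal R * ENNReal.ofReal R' := by
  obtain ⟨idx, φ, hidx, hM, hφ, hφs⟩ := exists_step_decomposition hR hp
  obtain ⟨idx', ψ, hidx', hM', hψ, hψs⟩ := exists_step_decomposition hR' hp'
  set w : ℕ → ℝ × ℝ → ℂ := fun n q => cutoffWave a₁ b₁ q.1 q.2 (φ n (idx n q.1)) with hw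
  set z : ℕ → ℝ × ℝ → ℂ := fun n q => cutoffWave a₂ b₂ q.1 q.2 (ψ n (idx' n q.1)) with hz
  have mw : ∀ n, Measurable (w n) := fun n => measurable_stepWave a₁ b₁ (hidx n) (φ n)
  have mz : ∀ n, Measurable (z n) := fun n => measurable_stepWave a₂ b₂ (hidx' n) (ψ n)
  set r : ℝ := (1 / 2) ^ ε with hr
  have hr0 : 0 < r := by positivity
  have hr1 : r < 1 := Real.rpow_lt_one (by norm_num) (by norm_num) hε
  set wz : ℕ → ℕ → ℝ × ℝ → ℂ := fun n m q => w n q * z m q with hwz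
  have mwz : ∀ n m, AEStronglyMeasurable (wz n m) (slab T) := fun n m =>
    ((mw n).mul (mz m)).aestronglyMeasurable
  have ewz : ∀ n m, eLpNorm (wz n m) 2 (slab T) ≤
      ENNReal.ofReal (32 * (R * R') * (T ^ (ε / 4) * lam ^ (-(1 / 2) + ε)) * r ^ (n + m)) :=
    fun n m => eLpNorm_stepWave_mul_le hε hε' hT hT1 hlam hsep (hidx n) (hidx' m) (hM n) (hM' m)
      hR hR' (hφ n) (hψ m)
  set f : ℕ → ℝ × ℝ → ℂ := fun N => ∑ n ∈ Finset.range N, ∑ m ∈ Finset.range N, wz n m with hf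
  have hmf : ∀ N, AEStronglyMeasurable (f N) (slab T) := fun N =>
    Finset.aestronglyMeasurable_sum _ fun n _ => Finset.aestronglyMeasurable_sum _ fun m _ =>
      mwz n m
  have hlim : ∀ q : ℝ × ℝ, Tendsto (fun N => f N q) atTop
      (𝓝 (cutoffWave a₁ b₁ q.1 q.2 (p q.1) * cutoffWave a₂ b₂ q.1 q.2 (p' q.1))) := by
    intro q
    have h1 := ((hφs q.1).map (cutoffWave a₁ b₁ q.1 q.2)
      (continuous_cutoffWave a₁ b₁ q.1 q.2)).tendsto_sum_nat
    have h2 := ((hψs q.1).map (cutoffWave a₂ b₂ q.1 q.2)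
      (continuous_cutoffWave a₂ b₂ q.1 q.2)).tendsto_sum_nat
    refine (h1.mul h2).congr fun N => ?_
    simp only [hf, Finset.sum_apply, Finset.sum_mul_sum]
    rfl
  refine ⟨aestronglyMeasurable_of_tendsto_ae _ hmf (ae_of_all _ hlim), ?_⟩
  -- Fatou: pointwise convergence and uniform bounds on the partial sums suffice.
  refine (Lp.eLpNorm_lim_le_liminf_eLpNorm hmf _ (ae_of_all _ hlim)).trans ?_
  refine liminf_le_of_frequently_le' (Frequently.of_forall fun N => ?_)
  set D := 32 * (R * R') * (T ^ (ε / 4) * lam ^ (-(1 / 2) + ε)) with hD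
  have hD0 : 0 < D := by positivity
  have hgeo : ∑ n ∈ Finset.range N, r ^ n ≤ (1 - r)⁻¹ := by
    rw [← tsum_geometric_of_lt_one hr0.le hr1]
    exact (summable_geometric_of_lt_one hr0.le hr1).sum_le_tsum _ fun _ _ => by positivity
  calc eLpNorm (f N) 2 (slab T)
      ≤ ∑ n ∈ Finset.range N, ∑ m ∈ Finset.range N, ENNReal.ofReal (D * r ^ (n + m)) := by
        refine (eLpNorm_sum_le (fun n _ => Finset.aestronglyMeasurable_sum _ fun m _ => mwz n m)
          one_le_two).trans (Finset.sum_le_sum fun n _ => ?_)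
        exact (eLpNorm_sum_le (fun m _ => mwz n m) one_le_two).trans
          (Finset.sum_le_sum fun m _ => ewz n m)
    _ = ENNReal.ofReal (D * ((∑ n ∈ Finset.range N, r ^ n) * ∑ m ∈ Finset.range N, r ^ m)) := by
        rw [Finset.sum_mul_sum, Finset.mul_sum, ENNReal.ofReal_sum_of_nonneg
          fun n _ => mul_nonneg hD0.le (Finset.sum_nonneg fun m _ => by positivity)]
        refine Finset.sum_congr rfl fun n _ => ?_
        rw [Finset.mul_sum, ENNReal.ofReal_sum_of_nonneg fun m _ => by positivity]
        simp_rw [pow_add]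
    _ ≤ ENNReal.ofReal (D * ((1 - r)⁻¹ * (1 - r)⁻¹)) := by
        refine ENNReal.ofReal_le_ofReal (mul_le_mul_of_nonneg_left ?_ hD0.le)
        have h0 : 0 ≤ ∑ n ∈ Finset.range N, r ^ n := Finset.sum_nonneg fun n _ => by positivity
        exact mul_le_mul hgeo hgeo h0 (h0.trans hgeo)
    _ = _ := by
        rw [← ENNReal.ofReal_mul (by positivity), ← ENNReal.ofReal_mul (by positivity), hD]
        congr 1
        ring

/-! ### Return to `productL2Norm` and conclusion -/

/-- The representatives `u t` are chosen separately for each `t`, so joint measurability must come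
from `g`; equality on almost every point of each time slice is enough for the iterated integral. -/
theorem productL2Norm_eq_eLpNorm {T : ℝ} {u v : ℝ → L2} {g : ℝ × ℝ → ℂ}
    (hg : AEStronglyMeasurable g (slab T))
    (h : ∀ t, (fun x => u t x * v t x) =ᵐ[volume] fun x => g (t, x)) :
    productL2Norm (Set.Icc 0 T) u v = eLpNorm g 2 (slab T) := by
  rw [eLpNorm_two_eq, slab, lintegral_prod _ (hg.enorm.pow_const 2), productL2Norm]
  congr 1
  refine lintegral_congr fun t => lintegral_congr_ae ?_
  filter_upwards [h t] with x hx
  rw [ENNReal.rpow_two, hx]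

theorem eq_zero_of_vNorm_eq_zero {p : ℝ → L2} (hp : vNorm 2 p = 0) (t : ℝ) : p t = 0 := by
  have := enorm_le_vNorm p t
  rw [hp] at this
  exact enorm_eq_zero.1 (le_antisymm this zero_le)

theorem eLpNorm_cutoffWave_mul_le {ε : ℝ} (hε : 0 < ε) (hε' : ε < 1 / 2)
    {T lam a₁ b₁ a₂ b₂ : ℝ} (hT : 0 < T) (hT1 : T ≤ 1) (hlam : 0 < lam)
    (hsep : ∀ ξ ∈ Set.Icc a₁ b₁, ∀ η ∈ Set.Icc a₂ b₂, lam ≤ |ξ - η|)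
    {p p' : ℝ → L2} (hp : vNorm 2 p ≠ ∞) (hp' : vNorm 2 p' ≠ ∞) :
    (AEStronglyMeasurable (fun q : ℝ × ℝ => cutoffWave a₁ b₁ q.1 q.2 (p q.1) *
        cutoffWave a₂ b₂ q.1 q.2 (p' q.1)) (slab T)) ∧
    eLpNorm (fun q : ℝ × ℝ => cutoffWave a₁ b₁ q.1 q.2 (p q.1) *
        cutoffWave a₂ b₂ q.1 q.2 (p' q.1)) 2 (slab T) ≤
      ENNReal.ofReal (32 * (1 - (1 / 2) ^ ε)⁻¹ ^ 2 * T ^ (ε / 4) * lam ^ (-(1 / 2) + ε)) *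
        vNorm 2 p * vNorm 2 p' := by
  -- The decomposition needs `R > 0`; a profile of zero norm vanishes identically.
  by_cases h0 : vNorm 2 p = 0
  · simp only [eq_zero_of_vNorm_eq_zero h0, map_zero, zero_mul]
    exact ⟨aestronglyMeasurable_const, by simp⟩
  by_cases h0' : vNorm 2 p' = 0
  · simp only [eq_zero_of_vNorm_eq_zero h0', map_zero, mul_zero]
    exact ⟨aestronglyMeasurable_const, by simp⟩
  have h := eLpNorm_cutoffWave_mul_le_of_vNorm_le hε hε' hT hT1 hlam hsep
    (ENNReal.toReal_pos h0 hp) (ENNReal.toReal_pos h0' hp')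
    (ENNReal.ofReal_toReal hp).ge (ENNReal.ofReal_toReal hp').ge
  rwa [ENNReal.ofReal_toReal hp, ENNReal.ofReal_toReal hp'] at h

theorem productL2Norm_schrodinger_le {lam a₁ b₁ a₂ b₂ : ℝ} (hlam : 0 < lam)
    (hsep : ∀ ξ ∈ Set.Icc a₁ b₁, ∀ η ∈ Set.Icc a₂ b₂, lam ≤ |ξ - η|) {u₀ v₀ : L2}
    (hu : FreqLocalized (Set.Icc a₁ b₁) u₀) (hv : FreqLocalized (Set.Icc a₂ b₂) v₀) :
    productL2Norm Set.univ (fun t => schrodinger t u₀) (fun t => schrodinger t v₀) ≤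
      ENNReal.ofReal (lam ^ (-(1 / 2) : ℝ)) * ‖u₀‖ₑ * ‖v₀‖ₑ := by
  have h : ∫⁻ t in Set.univ, ∫⁻ x : ℝ, ‖schrodinger t u₀ x * schrodinger t v₀ x‖ₑ ^ (2 : ℝ) ≤
      (ENNReal.ofReal (lam ^ (-(1 / 2) : ℝ)) * ‖u₀‖ₑ * ‖v₀‖ₑ) ^ 2 := by
    have hl : ENNReal.ofReal (lam ^ (-(1 / 2) : ℝ)) ^ 2 = ENNReal.ofReal (1 / lam) := by
      rw [← ENNReal.ofReal_pow (by positivity), ← Real.rpow_natCast, ← Real.rpow_mul hlam.le]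
      norm_num
      rw [Real.rpow_neg_one]
    rw [mul_pow, mul_pow, hl, setLIntegral_univ]
    refine le_trans (lintegral_mono fun t => le_of_eq (lintegral_congr_ae ?_))
      (lintegral_cutoffWave_mul_le hlam hsep u₀ v₀)
    filter_upwards [hu.coeFn_schrodinger t, hv.coeFn_schrodinger t] with x h1 h2
    rw [ENNReal.rpow_two, h1, h2]
  refine (ENNReal.rpow_le_rpow h (by norm_num)).trans_eq ?_
  rw [← ENNReal.rpow_natCast, ← ENNReal.rpow_mul]
  norm_num

theorem coeFn_eq_cutoffWave_schrodingerProfile {a b : ℝ} {u : ℝ → L2}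
    (hu : ∀ t, FreqLocalized (Set.Icc a b) (u t)) (t : ℝ) :
    (u t : ℝ → ℂ) =ᵐ[volume] fun x => cutoffWave a b t x (schrodingerProfile u t) := by
  have h := (freqLocalized_schrodinger (hu t) (-t)).coeFn_schrodinger t
  rwa [schrodinger_schrodinger_neg] at h

theorem mainTheorem5 :
    (∃ C : ℝ, 0 < C ∧
      ∀ (lam a₁ b₁ a₂ b₂ : ℝ), 0 < lam →
        (∀ ξ ∈ Set.Icc a₁ b₁, ∀ η ∈ Set.Icc a₂ b₂, lam ≤ |ξ - η|) →
        ∀ u₀ v₀ : L2,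
          FreqLocalized (Set.Icc a₁ b₁) u₀ → FreqLocalized (Set.Icc a₂ b₂) v₀ →
          productL2Norm Set.univ (fun t => schrodinger t u₀) (fun t => schrodinger t v₀) ≤
            ENNReal.ofReal (C * lam ^ (-(1 / 2) : ℝ)) * ‖u₀‖ₑ * ‖v₀‖ₑ) ∧
    (∀ ε : ℝ, 0 < ε → ε < 1 / 2 → ∃ C : ℝ, 0 < C ∧
      ∀ (T lam a₁ b₁ a₂ b₂ : ℝ), 0 < T → T ≤ 1 → 0 < lam →
        (∀ ξ ∈ Set.Icc a₁ b₁, ∀ η ∈ Set.Icc a₂ b₂, lam ≤ |ξ - η|) →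
        ∀ u v : ℝ → L2,
          MemVDelta 2 u → MemVDelta 2 v →
          (∀ t, FreqLocalized (Set.Icc a₁ b₁) (u t)) →
          (∀ t, FreqLocalized (Set.Icc a₂ b₂) (v t)) →
          productL2Norm (Set.Icc 0 T) u v ≤
            ENNReal.ofReal (C * T ^ (ε / 4) * lam ^ (-(1 / 2) + ε)) *
              vDeltaNorm 2 u * vDeltaNorm 2 v) := by
  refine ⟨⟨1, one_pos, fun lam a₁ b₁ a₂ b₂ hlam hsep u₀ v₀ hu hv => ?_⟩, fun ε hε hε' =>
    ⟨32 * (1 - (1 / 2) ^ ε)⁻¹ ^ 2, ?_,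
      fun T lam a₁ b₁ a₂ b₂ hT hT1 hlam hsep u v hu hv hfu hfv => ?_⟩⟩
  · rw [one_mul]
    exact productL2Norm_schrodinger_le hlam hsep hu hv
  · have : ((1 / 2 : ℝ)) ^ ε < 1 := Real.rpow_lt_one (by norm_num) (by norm_num) hε
    have : 0 < 1 - ((1 / 2 : ℝ)) ^ ε := by linarith
    positivity
  · obtain ⟨hm, hle⟩ := eLpNorm_cutoffWave_mul_le hε hε' hT hT1 hlam hsep hu.2.2.ne hv.2.2.ne
    rw [productL2Norm_eq_eLpNorm hm fun t => ?_]
    · exact hle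
    · filter_upwards [coeFn_eq_cutoffWave_schrodingerProfile hfu t,
        coeFn_eq_cutoffWave_schrodingerProfile hfv t] with x h1 h2
      rw [h1, h2]
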